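/- Let $n\ge 2$. For qubits $i\ne j$ of an $n$-qubit register consider the skew-Hermitian operators $$h_x^{ij}=-\tfrac{i}{4}\,(\sigma_x^i\sigma_x^j+\sigma_y^i\sigma_y^j)\prod_{k}\sigma_z^k,\qquad h_y^{ij}=-\tfrac{i}{4}\,(\sigma_y^i\sigma_x^j-\sigma_x^i\sigma_y^j)\prod_{k}\sigma_z^k,\qquad h_z^{ij}=-\tfrac{i}{4}\,(\sigma_z^i-\sigma_z^j),$$ where the products run over the qubits $k$ strictly between $i$ and $j$. They are the generators of the $\mathrm{SU}$ compound ansatz, and the real Lie algebra that they generate is its dynamical Lie algebra (DLA). Let $\phi$ be the representation of $\mathrm{SU}(n)$ on $\bigoplus_{k=0}^n\bigwedge^k\mathbb C^n\cong(\mathbb C^2)^{\otimes n}$, where the computational basis state with ones exactly at the qubits $i_1<\dots<i_k$ is identified with $e_{i_1}\wedge\dots\wedge e_{i_k}$, let $d\phi$ be its differential, and put $\|a\|_{\mathfrak g}^2=-\operatorname{Tr}(a^2)$ for $a\in\mathfrak{su}(n)$. For a skew-Hermitian $H$, a Hermitian $O$ and a state $\rho$ let $\mathrm{GradVar}$ be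 the variance, for independent Haar-random $g^+,g^-\in\mathrm{SU}(n)$, of $$\operatorname{Tr}\bigl\{\phi(g^-)^\dagger\rho\,\phi(g^-)\,[H,\phi(g^+)\,O\,\phi(g^+)^\dagger]\bigr\}.$$ The ansatz is a Lie algebra supported ansatz (LASA) if $iO$ belongs to the DLA. Let $\rho=(|+\rangle\langle +|)^{\otimes n}$. Then: 1. The DLA equals $d\phi(\mathfrak{su}(n))$ and has dimension $n^2-1$, and every generator is $d\phi(h)$ for some $h\in\mathfrak{su}(n)$ with $\|h\|_{\mathfrak g}^2=\tfrac12$. 2. If $H=d\phi(h)$ and $iO=d\phi(o)$ with $h,o\in\mathfrak{su}(n)$, then $$\mathrm{GradVar}=\frac{n(n-1)}{4(n^2-1)^2}\,\|h\|_{\mathfrak g}^2\,\|o\|_{\mathfrak g}^2 .$$ In particular, if $H$ is any generator and $O=\pm i$ times any generator, then $$\mathrm{GradVar}=\frac{n(n-1)}{16(n^2-1)^2}.$$ 3. Consequently, for every sequence (in $n$) of generators $H$ and of LASA observables $O$, $iO=d\phi(o)$, with $\|o\|_{\mathfrak g}^2=\Theta(1)$, one has $\mathrm{GradVar}=\Theta(1/n^2)$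 as $n\to\infty$; equivalently, $\mathrm{GradVar}$ is of the order of the inverse of the DLA dimension, $\Theta(1/(n^2-1))$. -/

import Mathlib

open scoped Matrix

attribute [local instance 100] LieRing.ofAssociativeRing

namespace CompoundAnsatz

/-! ### Qubits and Pauli operators -/

/-- Labels of the computational basis states of `n` qubits. -/
abbrev Bits (n : ℕ) : Type := Fin n → Fin 2

/-- Operators on the `n`-qubit Hilbert space, in the computational basis. -/
abbrev QOp (n : ℕ) : Type := Matrix (Bits n) (Bits n) ℂ

/-- The Pauli matrix `σ_x`. -/
def σx : Matrix (Fin 2) (Fin 2) ℂ := !![0, 1; 1, 0]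

/-- The Pauli matrix `σ_y`. -/
def σy : Matrix (Fin 2) (Fin 2) ℂ := !![0, -Complex.I; Complex.I, 0]

/-- The Pauli matrix `σ_z`. -/
def σz : Matrix (Fin 2) (Fin 2) ℂ := !![1, 0; 0, -1]

/-- The tensor product `P 0 ⊗ P 1 ⊗ ⋯ ⊗ P (n - 1)` of one-qubit operators. -/
def tensorOp {n : ℕ} (P : Fin n → Matrix (Fin 2) (Fin 2) ℂ) : QOp n :=
  Matrix.of fun x y => ∏ k, P k (x k) (y k)

/-- The operator with `A` on qubit `i`, `B` on qubit `j`, `σ_z` on every qubit strictly between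
`i` and `j`, and the identity on all other qubits. -/
def pauliString {n : ℕ} (A B : Matrix (Fin 2) (Fin 2) ℂ) (i j : Fin n) : QOp n :=
  tensorOp fun k =>
    if k = i then A
    else if k = j then B
    else if min i j < k ∧ k < max i j then σz
    else 1

/-- The one-qubit operator `A` acting on qubit `i`. -/
def onQubit {n : ℕ} (A : Matrix (Fin 2) (Fin 2) ℂ) (i : Fin n) : QOp n :=
  tensorOp fun k => if k = i then A else 1

/-! ### Generators of the compound ansatz, its dynamical Lie algebra -/

/-- `-(i/4) (σ_x^i σ_x^j + σ_y^i σ_y^j) σ_z ⋯ σ_z`. -/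
noncomputable def genX {n : ℕ} (i j : Fin n) : QOp n :=
  (-(Complex.I / 4)) • (pauliString σx σx i j + pauliString σy σy i j)

/-- `-(i/4) (σ_y^i σ_x^j - σ_x^i σ_y^j) σ_z ⋯ σ_z`. -/
noncomputable def genY {n : ℕ} (i j : Fin n) : QOp n :=
  (-(Complex.I / 4)) • (pauliString σy σx i j - pauliString σx σy i j)

/-- `-(i/4) (σ_z^i - σ_z^j)`. -/
noncomputable def genZ {n : ℕ} (i j : Fin n) : QOp n :=
  (-(Complex.I / 4)) • (onQubit σz i - onQubit σz j)

/-- The skew-Hermitian generators of the gates of the `SU` compound ansatz on `n` qubits. -/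
def generators (n : ℕ) : Set (QOp n) :=
  {H | ∃ i j : Fin n, i ≠ j ∧ (H = genX i j ∨ H = genY i j ∨ H = genZ i j)}

/-- The dynamical Lie algebra: the real Lie algebra generated by the gate generators. -/
noncomputable def dla (n : ℕ) : LieSubalgebra ℝ (QOp n) :=
  LieSubalgebra.lieSpan ℝ (QOp n) (generators n)

/-- The ansatz with observable `O` is a Lie algebra supported ansatz: `i O` lies in the
dynamical Lie algebra. -/
def IsLASA (n : ℕ) (O : QOp n) : Prop := Complex.I • O ∈ dla n

/-! ### The compound representation of `SU(n)` -/

/-- The group `SU(n)`. -/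
abbrev SUn (n : ℕ) : Type := Matrix.specialUnitaryGroup (Fin n) ℂ

/-- The set of qubits on which a bit string is `1`. -/
def bitsEquivFinset (n : ℕ) : Bits n ≃ Finset (Fin n) where
  toFun x := Finset.univ.filter fun i => x i = 1
  invFun s i := if i ∈ s then 1 else 0
  left_inv x := by
    funext i
    rcases Fin.exists_fin_two.mp ⟨x i, rfl⟩ with h | h <;> simp [h]
  right_inv s := by
    ext i
    simp

/-- The basis of `⋀ ℂⁿ` formed by the vectors `e_{i₁} ∧ ⋯ ∧ e_{iₖ}` with `i₁ < ⋯ < iₖ`, such a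
vector being labelled by the computational basis state whose ones are at `i₁, …, iₖ`. -/
noncomputable def wedgeBasis (n : ℕ) : Module.Basis (Bits n) ℂ (ExteriorAlgebra ℂ (Fin n → ℂ)) :=
  (Pi.basisFun ℂ (Fin n)).ExteriorAlgebra.reindex (bitsEquivFinset n).symm

/-- The compound matrix of `g`: the matrix of `⨁ₖ ⋀ᵏ g` on `⨁ₖ ⋀ᵏ ℂⁿ`, which is identified with
the `n`-qubit space through `wedgeBasis`. On `SU(n)` this is the representation `φ`. -/
noncomputable def compound {n : ℕ} (g : Matrix (Fin n) (Fin n) ℂ) : QOp n :=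
  LinearMap.toMatrix (wedgeBasis n) (wedgeBasis n)
    (ExteriorAlgebra.map (Matrix.toLin' g)).toLinearMap

/-- The Lie algebra `su(n)` of traceless skew-Hermitian matrices. -/
def su (n : ℕ) : Set (Matrix (Fin n) (Fin n) ℂ) := {a | aᴴ = -a ∧ a.trace = 0}

/-- The squared standard norm `‖a‖² = -Tr (a²)` on `su(n)`. -/
noncomputable def stdNormSq {n : ℕ} (a : Matrix (Fin n) (Fin n) ℂ) : ℝ := -((a * a).trace).re

/-- The differential of the compound representation:
`dφ(a) = d/dt φ(exp(t a))` at `t = 0`, entry by entry. -/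
noncomputable def dcompound {n : ℕ} (a : Matrix (Fin n) (Fin n) ℂ) : QOp n :=
  Matrix.of fun x y => deriv (fun t : ℝ => compound (NormedSpace.exp (t • a)) x y) 0

/-! ### Haar measure on `SU(n)` -/

instance instContinuousInvSUn (n : ℕ) : ContinuousInv (SUn n) where
  continuous_inv := by
    refine Continuous.subtype_mk ?_ _
    exact continuous_star.comp continuous_subtype_val

instance instIsTopologicalGroupSUn (n : ℕ) : IsTopologicalGroup (SUn n) where

instance instCompactSpaceSUn (n : ℕ) : CompactSpace (SUn n) := by
  refine isCompact_iff_compactSpace.mp ?_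
  have hK : IsCompact {A : Matrix (Fin n) (Fin n) ℂ |
      ∀ i, A i ∈ {v : Fin n → ℂ | ∀ j, v j ∈ Metric.closedBall (0 : ℂ) 1}} :=
    isCompact_pi_infinite fun _ => isCompact_pi_infinite fun _ => isCompact_closedBall 0 1
  refine hK.of_isClosed_subset ?_ ?_
  · have h : ((Matrix.specialUnitaryGroup (Fin n) ℂ : Submonoid (Matrix (Fin n) (Fin n) ℂ)) :
        Set (Matrix (Fin n) (Fin n) ℂ)) = {A | A * star A = 1} ∩ {A | A.det = 1} := by
      ext A
      simp [Matrix.mem_specialUnitaryGroup_iff, Matrix.mem_unitaryGroup_iff]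
    rw [h]
    exact (isClosed_eq (by fun_prop) continuous_const).inter
      (isClosed_eq (by fun_prop) continuous_const)
  · intro A hA i j
    simpa using entry_norm_bound_of_unitary (Matrix.mem_specialUnitaryGroup_iff.mp hA).1 i j

noncomputable instance instMeasurableSpaceSUn (n : ℕ) : MeasurableSpace (SUn n) := borel _

instance instBorelSpaceSUn (n : ℕ) : BorelSpace (SUn n) := ⟨rfl⟩

/-- The Haar probability measure on `SU(n)`. -/
noncomputable def haarSU (n : ℕ) : MeasureTheory.Measure (SUn n) :=
  MeasureTheory.Measure.haarMeasure ⊤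

/-! ### Gradient variance -/

/-- The abstracted gradient
`∂⟨O⟩_ρ = Tr (U₋† ρ U₋ [H, U₊ O U₊†])` with `U₊ = φ(g⁺)` and `U₋ = φ(g⁻)`. -/
noncomputable def gradient {n : ℕ} (H O ρ : QOp n) (gplus gminus : SUn n) : ℂ :=
  ((compound gminus.1)ᴴ * ρ * compound gminus.1 *
    ⁅H, compound gplus.1 * O * (compound gplus.1)ᴴ⁆).trace

/-- The variance of the abstracted gradient for independent Haar random `g⁺, g⁻` in `SU(n)`.
For skew-Hermitian `H` and Hermitian `O`, `ρ` the gradient is a real number. -/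
noncomputable def gradVar {n : ℕ} (H O ρ : QOp n) : ℝ :=
  ProbabilityTheory.variance (fun p : SUn n × SUn n => (gradient H O ρ p.1 p.2).re)
    ((haarSU n).prod (haarSU n))

/-- The state vector `|+⟩^{⊗ n}`, where `|+⟩ = (|0⟩ + |1⟩) / √2`. -/
noncomputable def plusVec (n : ℕ) : Bits n → ℂ := fun _ => ∏ _k : Fin n, ((1 / √2 : ℝ) : ℂ)

/-- The density matrix of the uniform superposition `|+⟩^{⊗ n}`. -/
noncomputable def plusState (n : ℕ) : QOp n := Matrix.vecMulVec (plusVec n) (star (plusVec n))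

end CompoundAnsatz

open CompoundAnsatz Filter Asymptotics

/-!
The Jordan–Wigner operators `c_i†`, `c_i` satisfy the canonical anticommutation relations and
create the basis of `⋀ ℂⁿ` from the vacuum, so `φ(g)` is the operator on Fock space with
`φ(g) c†(v) = c†(g v) φ(g)` that fixes the vacuum, and its differential is the second quantization
`dφ(a) = ∑ a_ij c_i† c_j`. This is an injective Lie algebra homomorphism, and the generators are
the images of matrices that span `su(n)`.

For the variance, `tr (ρ dφ(a)) = tr (P a)` with `P` the one-body density matrix of `ρ`, and the
gradient becomes `-i tr (P g₂ [h, g₁ o g₁†] g₂†)`. A bilinear form on matrices that is invariant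
under unitary conjugation is a combination of `tr (P Q)` and `tr P tr Q`. Averaging
`tr (P x) tr (Q x)` and `tr ([P, x] [Q, x])` over the orbit of a traceless matrix gives such forms,
which vanish at `P = Q = 1`, and the remaining coefficient is read off from matrix units. Applying
this first to `g₂` and then to `g₁` gives the second moment. For the uniform superposition, `P` is
`1/2` plus a quarter of the adjacency matrix of the path graph, because a string with a `σ_z` has
expectation zero.
-/

namespace CompoundAnsatz

/-! ### Tensor products of one-qubit operators -/

section TensorOp

variable {n : ℕ} {i j : Fin n}

lemma tensorOp_apply (P : Fin n → Matrix (Fin 2) (Fin 2) ℂ) (x y : Bits n) :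
    tensorOp P x y = ∏ k, P k (x k) (y k) := rfl

lemma tensorOp_mul (P Q : Fin n → Matrix (Fin 2) (Fin 2) ℂ) :
    tensorOp P * tensorOp Q = tensorOp fun k => P k * Q k := by
  ext x y
  simp only [tensorOp_apply, Matrix.mul_apply, Finset.prod_univ_sum, Fintype.piFinset_univ,
    Finset.prod_mul_distrib]

lemma tensorOp_one : tensorOp (fun _ : Fin n => 1) = 1 := by
  ext x y
  simp only [tensorOp_apply, Matrix.one_apply, Finset.prod_ite_zero, Finset.prod_const_one,
    Finset.mem_univ, forall_const, funext_iff]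

lemma tensorOp_conjTranspose (P : Fin n → Matrix (Fin 2) (Fin 2) ℂ) :
    (tensorOp P)ᴴ = tensorOp fun k => (P k)ᴴ := by
  ext x y
  simp [tensorOp_apply, Matrix.conjTranspose_apply]

lemma tensorOp_mulVec_single (P : Fin n → Matrix (Fin 2) (Fin 2) ℂ) {x y : Bits n}
    (h : ∀ k, (P k).col (x k) = Pi.single (y k) 1) :
    tensorOp P *ᵥ Pi.single x 1 = Pi.single y 1 := by
  ext z
  have hk (k : Fin n) : P k (z k) (x k) = if z k = y k then 1 else 0 := by
    simpa [Pi.single_apply] using congrFun (h k) (z k)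
  simp only [Matrix.mulVec_single_one, Matrix.col_apply, tensorOp_apply, hk, Pi.single_apply,
    Finset.prod_ite_zero, Finset.prod_const_one, Finset.mem_univ, forall_const, funext_iff]

/-- The tensor product of one-qubit operators as a multilinear map. -/
def tensorMultilinear (n : ℕ) :
    MultilinearMap ℂ (fun _ : Fin n => Matrix (Fin 2) (Fin 2) ℂ) (QOp n) where
  toFun := tensorOp
  map_update_add' P k A B := by
    ext x y
    exact ((MultilinearMap.mkPiAlgebra ℂ (Fin n) ℂ).compLinearMap fun k =>
      Matrix.entryLinearMap ℂ ℂ (x k) (y k)).map_update_add P k A B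
  map_update_smul' P k c A := by
    ext x y
    exact ((MultilinearMap.mkPiAlgebra ℂ (Fin n) ℂ).compLinearMap fun k =>
      Matrix.entryLinearMap ℂ ℂ (x k) (y k)).map_update_smul P k c A

lemma onQubit_eq_tensorMultilinear (A : Matrix (Fin 2) (Fin 2) ℂ) (i : Fin n) :
    onQubit A i = tensorMultilinear n (Function.update (fun _ => 1) i A) :=
  congrArg tensorOp (funext fun k => by simp only [Function.update_apply])

lemma onQubit_add (A B : Matrix (Fin 2) (Fin 2) ℂ) (i : Fin n) :
    onQubit (A + B) i = onQubit A i + onQubit B i := by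
  simp only [onQubit_eq_tensorMultilinear, MultilinearMap.map_update_add]

lemma onQubit_smul (c : ℂ) (A : Matrix (Fin 2) (Fin 2) ℂ) (i : Fin n) :
    onQubit (c • A) i = c • onQubit A i := by
  simp only [onQubit_eq_tensorMultilinear, MultilinearMap.map_update_smul]

lemma onQubit_zero (i : Fin n) : onQubit 0 i = 0 := by
  simpa using onQubit_smul 0 0 i

lemma onQubit_one (i : Fin n) : onQubit 1 i = 1 := by
  simp only [onQubit, ite_self, tensorOp_one]

lemma pauliString_eq_tensorMultilinear (A B : Matrix (Fin 2) (Fin 2) ℂ) (i j : Fin n) :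
    pauliString A B i j = tensorMultilinear n (Function.update
      (fun k => if k = j then B else if min i j < k ∧ k < max i j then σz else 1) i A) :=
  congrArg tensorOp (funext fun k => by simp only [Function.update_apply])

lemma pauliString_add_left (A A' B : Matrix (Fin 2) (Fin 2) ℂ) (i j : Fin n) :
    pauliString (A + A') B i j = pauliString A B i j + pauliString A' B i j := by
  simp only [pauliString_eq_tensorMultilinear, MultilinearMap.map_update_add]

lemma pauliString_smul_left (c : ℂ) (A B : Matrix (Fin 2) (Fin 2) ℂ) (i j : Fin n) :
    pauliString (c • A) B i j = c • pauliString A B i j := by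
  simp only [pauliString_eq_tensorMultilinear, MultilinearMap.map_update_smul]

lemma pauliString_swap (hij : i ≠ j) (A B : Matrix (Fin 2) (Fin 2) ℂ) :
    pauliString A B i j = pauliString B A j i := by
  refine congrArg tensorOp (funext fun k => ?_)
  rw [min_comm, max_comm]
  grind

lemma pauliString_add_right (hij : i ≠ j) (A B B' : Matrix (Fin 2) (Fin 2) ℂ) :
    pauliString A (B + B') i j = pauliString A B i j + pauliString A B' i j := by
  simp only [pauliString_swap hij A, pauliString_add_left]

lemma pauliString_smul_right (hij : i ≠ j) (c : ℂ) (A B : Matrix (Fin 2) (Fin 2) ℂ) :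
    pauliString A (c • B) i j = c • pauliString A B i j := by
  simp only [pauliString_swap hij A, pauliString_smul_left]

end TensorOp

/-! ### Fermionic modes -/

/-- The one-qubit raising operator `|1⟩⟨0|`. -/
def raiseMat : Matrix (Fin 2) (Fin 2) ℂ := !![0, 0; 1, 0]

/-- The one-qubit lowering operator `|0⟩⟨1|`. -/
def lowerMat : Matrix (Fin 2) (Fin 2) ℂ := !![0, 1; 0, 0]

/-- The Jordan–Wigner operator `σ_z ⊗ ⋯ ⊗ σ_z ⊗ A ⊗ 1 ⊗ ⋯ ⊗ 1` with `A` at position `i`: the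
string of `σ_z` makes odd one-qubit operators on different qubits anticommute. -/
def jordanWigner {n : ℕ} (A : Matrix (Fin 2) (Fin 2) ℂ) (i : Fin n) : QOp n :=
  tensorOp fun k => if k < i then σz else if k = i then A else 1

/-- The fermionic creation operator of mode `i`. -/
def cr {n : ℕ} (i : Fin n) : QOp n := jordanWigner raiseMat i

/-- The fermionic annihilation operator of mode `i`. -/
def an {n : ℕ} (i : Fin n) : QOp n := jordanWigner lowerMat i

/-- The vacuum vector `|0 ⋯ 0⟩` of the fermionic Fock space. -/
def vac (n : ℕ) : Bits n → ℂ := Pi.single 0 1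

section OneQubit

lemma σz_mul_σz : σz * σz = 1 := by
  ext i j; fin_cases i <;> fin_cases j <;> simp [σz]

lemma σz_conjTranspose : σzᴴ = σz := by
  ext i j; fin_cases i <;> fin_cases j <;> simp [σz]

lemma raiseMat_conjTranspose : raiseMatᴴ = lowerMat := by
  ext i j; fin_cases i <;> fin_cases j <;> simp [raiseMat, lowerMat]

lemma raiseMat_mul_σz : raiseMat * σz = raiseMat := by
  ext i j; fin_cases i <;> fin_cases j <;> simp [raiseMat, σz]

lemma σz_mul_raiseMat : σz * raiseMat = -raiseMat := by
  ext i j; fin_cases i <;> fin_cases j <;> simp [raiseMat, σz]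

lemma lowerMat_mul_σz : lowerMat * σz = -lowerMat := by
  ext i j; fin_cases i <;> fin_cases j <;> simp [lowerMat, σz]

lemma σz_mul_lowerMat : σz * lowerMat = lowerMat := by
  ext i j; fin_cases i <;> fin_cases j <;> simp [lowerMat, σz]

lemma raiseMat_mul_raiseMat : raiseMat * raiseMat = 0 := by
  ext i j; fin_cases i <;> fin_cases j <;> simp [raiseMat]

lemma lowerMat_mul_raiseMat_add : lowerMat * raiseMat + raiseMat * lowerMat = 1 := by
  ext i j; fin_cases i <;> fin_cases j <;> simp [lowerMat, raiseMat]

lemma σx_eq : σx = raiseMat + lowerMat := by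
  ext i j; fin_cases i <;> fin_cases j <;> simp [σx, lowerMat, raiseMat]

lemma σy_eq : σy = Complex.I • (raiseMat + (-1 : ℂ) • lowerMat) := by
  ext i j; fin_cases i <;> fin_cases j <;> simp [σy, lowerMat, raiseMat]

lemma σz_eq : σz = 1 + (-2 : ℂ) • (raiseMat * lowerMat) := by
  ext i j; fin_cases i <;> fin_cases j <;> simp [σz, lowerMat, raiseMat]; norm_num

lemma σz_col_zero : σz.col 0 = Pi.single 0 1 := by
  ext i; fin_cases i <;> simp [σz]

lemma raiseMat_col_zero : raiseMat.col 0 = Pi.single 1 1 := by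
  ext i; fin_cases i <;> simp [raiseMat]

end OneQubit

section CanonicalAnticommutation

variable {n : ℕ} {i j : Fin n}

lemma jordanWigner_mul_self (A B : Matrix (Fin 2) (Fin 2) ℂ) (i : Fin n) :
    jordanWigner A i * jordanWigner B i = onQubit (A * B) i := by
  rw [jordanWigner, jordanWigner, tensorOp_mul]
  refine congrArg tensorOp (funext fun k => ?_)
  rcases lt_trichotomy k i with h | rfl | h
  · simp [h, h.ne, σz_mul_σz]
  · simp
  · simp [h.not_gt, h.ne']

lemma jordanWigner_mul_of_lt (hij : i < j) (A B : Matrix (Fin 2) (Fin 2) ℂ) :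
    jordanWigner A i * jordanWigner B j = pauliString (A * σz) B i j := by
  rw [jordanWigner, jordanWigner, tensorOp_mul]
  refine congrArg tensorOp (funext fun k => ?_)
  rw [min_eq_left hij.le, max_eq_right hij.le]
  rcases lt_trichotomy k i with h | rfl | h
  · simp [h, h.trans hij, h.ne, (h.trans hij).ne, h.not_gt, σz_mul_σz]
  · simp [hij]
  · simp only [h.not_gt, h.ne', if_false, h, true_and, one_mul]
    grind

lemma jordanWigner_mul_of_gt (hij : j < i) (A B : Matrix (Fin 2) (Fin 2) ℂ) :
    jordanWigner A i * jordanWigner B j = pauliString A (σz * B) i j := by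
  rw [jordanWigner, jordanWigner, tensorOp_mul]
  refine congrArg tensorOp (funext fun k => ?_)
  rw [min_eq_right hij.le, max_eq_left hij.le]
  rcases lt_trichotomy k j with h | rfl | h
  · simp [h, h.trans hij, h.ne, (h.trans hij).ne, h.not_gt, σz_mul_σz]
  · simp [hij, hij.ne]
  · simp only [h.not_gt, h.ne', if_false, h, true_and, mul_one]
    grind

lemma cr_mul_an_self (i : Fin n) : cr i * an i = onQubit (raiseMat * lowerMat) i :=
  jordanWigner_mul_self _ _ i

lemma cr_mul_an_of_ne (hij : i ≠ j) : cr i * an j = pauliString raiseMat lowerMat i j := by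
  rcases lt_or_gt_of_ne hij with h | h
  · rw [cr, an, jordanWigner_mul_of_lt h, raiseMat_mul_σz]
  · rw [cr, an, jordanWigner_mul_of_gt h, σz_mul_lowerMat]

lemma jordanWigner_anticomm {A B : Matrix (Fin 2) (Fin 2) ℂ} (hij : i ≠ j)
    (hA : σz * A = -(A * σz)) (hB : σz * B = -(B * σz)) :
    jordanWigner A i * jordanWigner B j = -(jordanWigner B j * jordanWigner A i) := by
  rcases lt_or_gt_of_ne hij with h | h
  · rw [jordanWigner_mul_of_lt h, jordanWigner_mul_of_gt h, pauliString_swap hij.symm, hA,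
      ← neg_one_smul ℂ (A * σz), pauliString_smul_left, neg_one_smul, neg_neg]
  · rw [jordanWigner_mul_of_gt h, jordanWigner_mul_of_lt h, pauliString_swap hij, hB,
      ← neg_one_smul ℂ (B * σz), pauliString_smul_left, neg_one_smul]

lemma σz_mul_raiseMat_eq_neg : σz * raiseMat = -(raiseMat * σz) := by
  rw [σz_mul_raiseMat, raiseMat_mul_σz]

lemma σz_mul_lowerMat_eq_neg : σz * lowerMat = -(lowerMat * σz) := by
  rw [σz_mul_lowerMat, lowerMat_mul_σz, neg_neg]

lemma cr_mul_cr (i j : Fin n) : cr i * cr j = -(cr j * cr i) := by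
  rcases eq_or_ne i j with rfl | h
  · rw [cr, jordanWigner_mul_self, raiseMat_mul_raiseMat, onQubit_zero, neg_zero]
  · exact jordanWigner_anticomm h σz_mul_raiseMat_eq_neg σz_mul_raiseMat_eq_neg

lemma an_mul_cr (i j : Fin n) : an i * cr j = (if i = j then 1 else 0) - cr j * an i := by
  split_ifs with h
  · subst h
    rw [eq_sub_iff_add_eq, cr_mul_an_self, an, cr, jordanWigner_mul_self, ← onQubit_add,
      lowerMat_mul_raiseMat_add, onQubit_one]
  · rw [zero_sub]
    exact jordanWigner_anticomm h σz_mul_lowerMat_eq_neg σz_mul_raiseMat_eq_neg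

lemma cr_conjTranspose (i : Fin n) : (cr i)ᴴ = an i := by
  rw [cr, jordanWigner, tensorOp_conjTranspose]
  refine congrArg tensorOp (funext fun k => ?_)
  simp only [apply_ite Matrix.conjTranspose, σz_conjTranspose, raiseMat_conjTranspose,
    Matrix.conjTranspose_one]

lemma cr_mulVec_single (i : Fin n) (x : Bits n) (hx : ∀ k ≤ i, x k = 0) :
    cr i *ᵥ Pi.single x 1 = Pi.single (Function.update x i 1) 1 := by
  refine tensorOp_mulVec_single _ fun k => ?_
  rcases lt_trichotomy k i with h | rfl | h
  · simp [h, h.ne, hx k h.le, σz_col_zero]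
  · simp [hx k le_rfl, raiseMat_col_zero]
  · simp only [h.not_gt, h.ne', if_false, Function.update_of_ne h.ne']
    rw [← Matrix.mulVec_single_one, Matrix.one_mulVec]

lemma an_mulVec_vac (i : Fin n) : an i *ᵥ vac n = 0 := by
  ext y
  rw [vac, Matrix.mulVec_single_one, Matrix.col_apply, an, jordanWigner, tensorOp_apply]
  refine Finset.prod_eq_zero (Finset.mem_univ i) ?_
  rcases Fin.exists_fin_two.mp ⟨y i, rfl⟩ with h | h <;> simp [h, lowerMat]

/-- The creation operator of the single-particle state `v`. -/
noncomputable def crV : (Fin n → ℂ) →ₗ[ℂ] QOp n := Fintype.linearCombination ℂ cr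

lemma crV_apply (v : Fin n → ℂ) : crV v = ∑ i, v i • cr i := rfl

lemma crV_single (i : Fin n) : crV (Pi.single i 1) = cr i := by
  rw [crV, Fintype.linearCombination_apply_single, one_smul]

lemma crV_conjTranspose (v : Fin n → ℂ) : (crV v)ᴴ = ∑ i, star (v i) • an i := by
  simp only [crV_apply, Matrix.conjTranspose_sum, Matrix.conjTranspose_smul, cr_conjTranspose]

lemma crV_mul_crV (v w : Fin n → ℂ) : crV v * crV w = -(crV w * crV v) := by
  simp only [crV_apply, Finset.sum_mul_sum, smul_mul_smul_comm]
  rw [Finset.sum_comm]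
  simp only [← Finset.sum_neg_distrib, ← smul_neg, ← cr_mul_cr, mul_comm (w _)]

lemma crV_mul_self (v : Fin n → ℂ) : crV v * crV v = 0 := by
  have h := crV_mul_crV v v
  rw [eq_neg_iff_add_eq_zero, ← two_smul ℂ] at h
  exact (smul_eq_zero.mp h).resolve_left two_ne_zero

lemma an_mul_crV (i : Fin n) (v : Fin n → ℂ) :
    an i * crV v = v i • (1 : QOp n) - crV v * an i := by
  simp only [crV_apply, Finset.mul_sum, Finset.sum_mul, mul_smul_comm, smul_mul_assoc, an_mul_cr,
    smul_sub, Finset.sum_sub_distrib, smul_ite, smul_zero, Finset.sum_ite_eq, Finset.mem_univ,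
    if_true]

lemma crV_conjTranspose_mul_crV (v w : Fin n → ℂ) :
    (crV v)ᴴ * crV w = (star v ⬝ᵥ w) • (1 : QOp n) - crV w * (crV v)ᴴ := by
  simp only [crV_conjTranspose, Finset.sum_mul, Finset.mul_sum, smul_mul_assoc, mul_smul_comm,
    an_mul_crV, smul_sub, Finset.sum_sub_distrib, smul_smul, ← Finset.sum_smul, dotProduct,
    Pi.star_apply]

lemma crV_conjTranspose_mulVec_vac (v : Fin n → ℂ) : (crV v)ᴴ *ᵥ vac n = 0 := by
  simp only [crV_conjTranspose, Matrix.sum_mulVec, Matrix.smul_mulVec, an_mulVec_vac, smul_zero,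
    Finset.sum_const_zero]

end CanonicalAnticommutation

/-! ### The exterior algebra as a Fock space -/

section Fock

variable {n : ℕ}

lemma prod_map_cr_mulVec_vac (l : List (Fin n)) (hl : l.Pairwise (· < ·)) :
    (l.map cr).prod *ᵥ vac n = Pi.single ((bitsEquivFinset n).symm l.toFinset) 1 := by
  induction l with
  | nil =>
    rw [List.map_nil, List.prod_nil, Matrix.one_mulVec, vac]
    congr 1
  | cons i l ih =>
    rw [List.pairwise_cons] at hl
    rw [List.map_cons, List.prod_cons, ← Matrix.mulVec_mulVec, ih hl.2, cr_mulVec_single]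
    · congr 1
      funext k
      rcases eq_or_ne k i with rfl | h
      · simp [bitsEquivFinset]
      · simp [bitsEquivFinset, h]
    · intro k hk
      have hkl : k ∉ l := fun h => (hl.1 k h).not_ge hk
      simp [bitsEquivFinset, hkl]

/-- The action of the exterior algebra of the single-particle space on the `n`-qubit space, in
which a vector `v` acts by its creation operator `crV v`. -/
noncomputable def fockRep (n : ℕ) : ExteriorAlgebra ℂ (Fin n → ℂ) →ₐ[ℂ] QOp n :=
  ExteriorAlgebra.lift ℂ ⟨crV, crV_mul_self⟩

lemma fockRep_ι (v : Fin n → ℂ) : fockRep n (ExteriorAlgebra.ι ℂ v) = crV v :=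
  ExteriorAlgebra.lift_ι_apply _ _ _ _

lemma fockRep_wedgeBasis (x : Bits n) :
    fockRep n (wedgeBasis n x) =
      (((bitsEquivFinset n x).sort (· ≤ ·)).map cr).prod := by
  set s : Finset (Fin n) := bitsEquivFinset n x
  have hb : wedgeBasis n x = (List.ofFn fun i =>
      ExteriorAlgebra.ι ℂ (Pi.single (s.orderEmbOfFin rfl i) (1 : ℂ))).prod := by
    rw [wedgeBasis, Module.Basis.reindex_apply, Equiv.symm_symm,
      ExteriorAlgebra.basis_apply_ofCard _ (rfl : s.card = _),
      ExteriorAlgebra.ιMulti_family, ExteriorAlgebra.ιMulti_apply]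
    simp only [Set.powersetCard.ofFinEmbEquiv_symm_apply, Pi.basisFun_apply, Function.comp_apply]
    rfl
  rw [hb, map_list_prod, List.map_ofFn]
  congr 1
  refine List.ext_getElem (by simp) fun i h₁ h₂ => ?_
  simp only [List.getElem_ofFn, Function.comp_apply, fockRep_ι, crV_single, List.getElem_map]
  rfl

lemma equivFun_wedgeBasis (w : ExteriorAlgebra ℂ (Fin n → ℂ)) :
    (wedgeBasis n).equivFun w = fockRep n w *ᵥ vac n := by
  have h : (wedgeBasis n).equivFun.toLinearMap =
      (LinearMap.flip (Matrix.mulVecBilin ℂ ℂ) (vac n)) ∘ₗ (fockRep n).toLinearMap := by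
    refine (wedgeBasis n).ext fun x => ?_
    simp only [LinearMap.comp_apply, LinearMap.flip_apply, AlgHom.toLinearMap_apply,
      Matrix.mulVecBilin_apply, LinearEquiv.coe_coe, fockRep_wedgeBasis]
    rw [prod_map_cr_mulVec_vac _ (Finset.sortedLT_sort _).pairwise, Finset.sort_toFinset,
      Equiv.symm_apply_apply]
    ext y
    simp [Module.Basis.equivFun_self, Pi.single_apply, eq_comm]
  exact LinearMap.congr_fun h w

lemma exists_fockRep_mulVec_vac (v : Bits n → ℂ) : ∃ w, fockRep n w *ᵥ vac n = v :=
  ⟨(wedgeBasis n).equivFun.symm v, by rw [← equivFun_wedgeBasis, LinearEquiv.apply_symm_apply]⟩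

@[elab_as_elim]
lemma fock_induction {p : (Bits n → ℂ) → Prop} (smul_vac : ∀ c : ℂ, p (c • vac n))
    (add : ∀ v w, p v → p w → p (v + w)) (crV_mulVec : ∀ u v, p v → p (crV u *ᵥ v))
    (v : Bits n → ℂ) : p v := by
  obtain ⟨w, rfl⟩ := exists_fockRep_mulVec_vac v
  induction w using CliffordAlgebra.left_induction with
  | algebraMap c =>
    rw [AlgHom.commutes, Algebra.algebraMap_eq_smul_one, Matrix.smul_mulVec, Matrix.one_mulVec]
    exact smul_vac c
  | add x y hx hy =>
    rw [map_add, Matrix.add_mulVec]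
    exact add _ _ hx hy
  | ι_mul x u hx =>
    rw [map_mul, ← Matrix.mulVec_mulVec]
    exact (fockRep_ι u).symm ▸ crV_mulVec u _ hx

lemma matrix_ext_of_fock {A B : QOp n} (vac : A *ᵥ vac n = B *ᵥ vac n)
    (crV_mulVec : ∀ u v, A *ᵥ v = B *ᵥ v → A *ᵥ (crV u *ᵥ v) = B *ᵥ (crV u *ᵥ v)) : A = B := by
  refine Matrix.ext_of_mulVec_single fun x => ?_
  induction (Pi.single x 1 : Bits n → ℂ) using fock_induction with
  | smul_vac c => rw [Matrix.mulVec_smul, Matrix.mulVec_smul, vac]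
  | add v w hv hw => rw [Matrix.mulVec_add, Matrix.mulVec_add, hv, hw]
  | crV_mulVec u v hv => exact crV_mulVec u v hv

lemma matrix_eq_of_intertwines_crV {A B : QOp n} (C : (Fin n → ℂ) → QOp n)
    (h : A *ᵥ vac n = B *ᵥ vac n) (hA : ∀ u, A * crV u = C u * A)
    (hB : ∀ u, B * crV u = C u * B) : A = B :=
  matrix_ext_of_fock h fun u v hv => by
    rw [Matrix.mulVec_mulVec, Matrix.mulVec_mulVec, hA, hB, ← Matrix.mulVec_mulVec, hv,
      Matrix.mulVec_mulVec]

end Fock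

/-! ### The compound representation -/

section Compound

variable {n : ℕ}

lemma compound_one : compound (1 : Matrix (Fin n) (Fin n) ℂ) = 1 := by
  rw [compound, Matrix.toLin'_one, ExteriorAlgebra.map_id, AlgHom.toLinearMap_id,
    LinearMap.toMatrix_id]

lemma compound_mul (g h : Matrix (Fin n) (Fin n) ℂ) :
    compound (g * h) = compound g * compound h := by
  rw [compound, Matrix.toLin'_mul, ← ExteriorAlgebra.map_comp_map, AlgHom.comp_toLinearMap,
    LinearMap.toMatrix_comp _ (wedgeBasis n)]
  rfl

lemma compound_mulVec_fockRep (g : Matrix (Fin n) (Fin n) ℂ)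
    (w : ExteriorAlgebra ℂ (Fin n → ℂ)) :
    compound g *ᵥ (fockRep n w *ᵥ vac n) =
      fockRep n (ExteriorAlgebra.map (Matrix.toLin' g) w) *ᵥ vac n := by
  rw [← equivFun_wedgeBasis, ← equivFun_wedgeBasis]
  exact LinearMap.toMatrix_mulVec_repr (wedgeBasis n) (wedgeBasis n) _ w

lemma compound_mulVec_vac (g : Matrix (Fin n) (Fin n) ℂ) : compound g *ᵥ vac n = vac n := by
  simpa using compound_mulVec_fockRep g 1

lemma compound_mul_crV (g : Matrix (Fin n) (Fin n) ℂ) (v : Fin n → ℂ) :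
    compound g * crV v = crV (g *ᵥ v) * compound g := by
  refine Matrix.ext_of_mulVec_single fun x => ?_
  obtain ⟨w, hw⟩ := exists_fockRep_mulVec_vac (Pi.single x (1 : ℂ))
  rw [← hw, ← Matrix.mulVec_mulVec, ← Matrix.mulVec_mulVec, compound_mulVec_fockRep,
    Matrix.mulVec_mulVec _ (crV v), ← fockRep_ι v, ← map_mul, compound_mulVec_fockRep, map_mul,
    ExteriorAlgebra.map_apply_ι, map_mul, fockRep_ι, Matrix.toLin'_apply, Matrix.mulVec_mulVec]

lemma crV_conjTranspose_mul_compound (g : Matrix (Fin n) (Fin n) ℂ) (v : Fin n → ℂ) :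
    (crV v)ᴴ * compound g = compound g * (crV (gᴴ *ᵥ v))ᴴ := by
  refine matrix_ext_of_fock ?_ fun u x hx => ?_
  · simp only [← Matrix.mulVec_mulVec, compound_mulVec_vac, crV_conjTranspose_mulVec_vac,
      Matrix.mulVec_zero]
  · have hdot : star (gᴴ *ᵥ v) ⬝ᵥ u = star v ⬝ᵥ (g *ᵥ u) := by
      rw [Matrix.star_mulVec, Matrix.conjTranspose_conjTranspose, Matrix.dotProduct_mulVec]
    have hl : (crV v)ᴴ * compound g * crV u =
        (star v ⬝ᵥ (g *ᵥ u)) • compound g - crV (g *ᵥ u) * ((crV v)ᴴ * compound g) := by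
      rw [mul_assoc, compound_mul_crV, ← mul_assoc, crV_conjTranspose_mul_crV, sub_mul,
        smul_one_mul, mul_assoc]
    have hr : compound g * (crV (gᴴ *ᵥ v))ᴴ * crV u = (star v ⬝ᵥ (g *ᵥ u)) • compound g -
        crV (g *ᵥ u) * (compound g * (crV (gᴴ *ᵥ v))ᴴ) := by
      rw [mul_assoc, crV_conjTranspose_mul_crV, hdot, mul_sub, mul_smul_one, ← mul_assoc,
        compound_mul_crV, mul_assoc]
    rw [Matrix.mulVec_mulVec, Matrix.mulVec_mulVec, hl, hr, Matrix.sub_mulVec, Matrix.sub_mulVec,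
      ← Matrix.mulVec_mulVec _ (crV _), ← Matrix.mulVec_mulVec _ (crV _), hx]

lemma star_vac : star (vac n) = vac n := by
  rw [vac, ← Pi.single_star, star_one]

lemma vac_vecMul_crV (v : Fin n → ℂ) : vac n ᵥ* crV v = 0 := by
  rw [← star_eq_zero, Matrix.star_vecMul, star_vac, crV_conjTranspose_mulVec_vac]

lemma vac_vecMul_compound (g : Matrix (Fin n) (Fin n) ℂ) : vac n ᵥ* compound g = vac n := by
  refine dotProduct_eq _ _ fun x => ?_
  induction x using fock_induction with
  | smul_vac c =>
    rw [← Matrix.dotProduct_mulVec, Matrix.mulVec_smul, compound_mulVec_vac]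
  | add x y hx hy => rw [dotProduct_add, dotProduct_add, hx, hy]
  | crV_mulVec u x _ =>
    rw [← Matrix.dotProduct_mulVec, Matrix.mulVec_mulVec, compound_mul_crV,
      Matrix.dotProduct_mulVec, Matrix.dotProduct_mulVec, ← Matrix.vecMul_vecMul, vac_vecMul_crV,
      vac_vecMul_crV, Matrix.zero_vecMul, zero_dotProduct]

lemma compound_conjTranspose (g : Matrix (Fin n) (Fin n) ℂ) : (compound g)ᴴ = compound gᴴ := by
  refine matrix_eq_of_intertwines_crV (fun v => crV (gᴴ *ᵥ v)) ?_ (fun v => ?_)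
    (compound_mul_crV gᴴ)
  · rw [compound_mulVec_vac, ← star_vac, ← Matrix.star_vecMul, vac_vecMul_compound]
  · simpa only [Matrix.conjTranspose_mul, Matrix.conjTranspose_conjTranspose] using
      congrArg Matrix.conjTranspose (crV_conjTranspose_mul_compound g v)

end Compound

/-! ### Second quantization -/

section SecondQuantization

variable {n : ℕ}

/-- The second quantization `∑ a i j • (cr i * an j)` of a one-particle operator `a`. -/
noncomputable def oneBody : Matrix (Fin n) (Fin n) ℂ →ₗ[ℂ] QOp n where
  toFun a := ∑ i, ∑ j, a i j • (cr i * an j)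
  map_add' a b := by simp only [Matrix.add_apply, add_smul, Finset.sum_add_distrib]
  map_smul' c a := by
    simp only [Matrix.smul_apply, smul_assoc, Finset.smul_sum, RingHom.id_apply]

lemma oneBody_apply (a : Matrix (Fin n) (Fin n) ℂ) :
    oneBody a = ∑ i, ∑ j, a i j • (cr i * an j) := rfl

lemma oneBody_single (i j : Fin n) (c : ℂ) :
    oneBody (Matrix.single i j c) = c • (cr i * an j) := by
  simp only [oneBody_apply, Matrix.single_apply, ite_and, ite_smul, zero_smul, Finset.sum_ite_irrel,
    Finset.sum_const_zero, Finset.sum_ite_eq, Finset.mem_univ, if_true]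

lemma oneBody_mul_conjTranspose {κ : Type*} [Fintype κ] (M N : Matrix (Fin n) κ ℂ) :
    oneBody (M * Nᴴ) = ∑ k, crV (M.col k) * (crV (N.col k))ᴴ := by
  simp only [crV_conjTranspose]
  simp only [oneBody_apply, crV_apply, Finset.sum_mul_sum, smul_mul_smul_comm, Matrix.mul_apply,
    Matrix.conjTranspose_apply, Finset.sum_smul, Matrix.col_apply]
  rw [Finset.sum_comm (s := (Finset.univ : Finset κ))]
  exact Finset.sum_congr rfl fun i _ => Finset.sum_comm

lemma oneBody_eq_sum_crV (a : Matrix (Fin n) (Fin n) ℂ) :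
    oneBody a = ∑ j, crV (a.col j) * an j := by
  have h := oneBody_mul_conjTranspose a 1
  simpa only [Matrix.conjTranspose_one, mul_one, ← Matrix.mulVec_single_one, Matrix.one_mulVec,
    crV_single, cr_conjTranspose] using h

lemma oneBody_mulVec_vac (a : Matrix (Fin n) (Fin n) ℂ) : oneBody a *ᵥ vac n = 0 := by
  simp only [oneBody_eq_sum_crV, Matrix.sum_mulVec, ← Matrix.mulVec_mulVec, an_mulVec_vac,
    Matrix.mulVec_zero, Finset.sum_const_zero]

lemma oneBody_mul_crV (a : Matrix (Fin n) (Fin n) ℂ) (v : Fin n → ℂ) :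
    oneBody a * crV v = crV (a *ᵥ v) + crV v * oneBody a := by
  have h (j : Fin n) : crV (a.col j) * an j * crV v =
      crV (v j • a.col j) + crV v * (crV (a.col j) * an j) := by
    rw [mul_assoc, an_mul_crV, mul_sub, mul_smul_comm, mul_one, ← mul_assoc, crV_mul_crV, map_smul,
      neg_mul, sub_neg_eq_add, mul_assoc]
  have hv : ∑ j, v j • a.col j = a *ᵥ v := by
    ext k
    simp [Matrix.mulVec, dotProduct, mul_comm]
  rw [oneBody_eq_sum_crV, Finset.sum_mul, Finset.sum_congr rfl fun j _ => h j,
    Finset.sum_add_distrib, Finset.mul_sum, ← map_sum, hv]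

lemma oneBody_lie (a b : Matrix (Fin n) (Fin n) ℂ) : ⁅oneBody a, oneBody b⁆ = oneBody ⁅a, b⁆ := by
  have hmul (a b : Matrix (Fin n) (Fin n) ℂ) (u : Fin n → ℂ) : oneBody a * oneBody b * crV u =
      crV ((a * b) *ᵥ u) + crV (b *ᵥ u) * oneBody a + crV (a *ᵥ u) * oneBody b +
        crV u * (oneBody a * oneBody b) := by
    rw [mul_assoc, oneBody_mul_crV, mul_add, ← mul_assoc, oneBody_mul_crV, oneBody_mul_crV,
      Matrix.mulVec_mulVec]
    noncomm_ring
  rw [← sub_eq_zero]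
  refine matrix_eq_of_intertwines_crV crV ?_ (fun u => ?_) (fun u => by simp)
  · simp only [Ring.lie_def, Matrix.sub_mulVec, ← Matrix.mulVec_mulVec, oneBody_mulVec_vac,
      Matrix.mulVec_zero, Matrix.zero_mulVec, sub_zero]
  · rw [Ring.lie_def, sub_mul, sub_mul, hmul, hmul, oneBody_mul_crV, Ring.lie_def,
      Matrix.sub_mulVec, map_sub]
    noncomm_ring

open scoped ComplexOrder in
lemma eq_zero_of_crV_mulVec_vac {w : Fin n → ℂ} (h : crV w *ᵥ vac n = 0) : w = 0 := by
  have hnorm : ((crV w)ᴴ * crV w) *ᵥ vac n = (star w ⬝ᵥ w) • vac n := by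
    rw [crV_conjTranspose_mul_crV, Matrix.sub_mulVec, ← Matrix.mulVec_mulVec,
      crV_conjTranspose_mulVec_vac, Matrix.mulVec_zero, sub_zero, Matrix.smul_mulVec,
      Matrix.one_mulVec]
  rw [← Matrix.mulVec_mulVec, h, Matrix.mulVec_zero] at hnorm
  exact dotProduct_star_self_eq_zero.mp (by simpa [vac] using (congrFun hnorm 0).symm)

lemma oneBody_injective : Function.Injective (oneBody (n := n)) := by
  refine (injective_iff_map_eq_zero _).mpr fun a ha => ?_
  refine Matrix.ext_of_mulVec_single fun j => ?_
  have h := oneBody_mul_crV a (Pi.single j 1)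
  rw [ha, zero_mul, mul_zero, add_zero] at h
  rw [Matrix.zero_mulVec]
  exact eq_zero_of_crV_mulVec_vac (by rw [← h, Matrix.zero_mulVec])

lemma compound_mul_oneBody_mul (g a : Matrix (Fin n) (Fin n) ℂ) :
    compound g * oneBody (a * g) = oneBody (g * a) * compound g := by
  have hl := oneBody_mul_conjTranspose a gᴴ
  have hr := oneBody_eq_sum_crV (g * a)
  simp only [Matrix.conjTranspose_conjTranspose] at hl
  rw [hl, hr, Finset.mul_sum, Finset.sum_mul]
  refine Finset.sum_congr rfl fun k _ => ?_
  rw [← mul_assoc, compound_mul_crV, mul_assoc, ← Matrix.mulVec_single_one gᴴ,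
    ← crV_conjTranspose_mul_compound, crV_single, cr_conjTranspose, ← mul_assoc,
    ← Matrix.mulVec_single_one, ← Matrix.mulVec_single_one, Matrix.mulVec_mulVec]

lemma compound_conj_oneBody {g : Matrix (Fin n) (Fin n) ℂ} (hg : gᴴ * g = 1)
    (a : Matrix (Fin n) (Fin n) ℂ) :
    compound g * oneBody a * (compound g)ᴴ = oneBody (g * a * gᴴ) := by
  have ha : a = a * gᴴ * g := by rw [mul_assoc, hg, mul_one]
  have hg' : compound g * (compound g)ᴴ = 1 := by
    rw [compound_conjTranspose, ← compound_mul, mul_eq_one_comm.mp hg, compound_one]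
  conv_lhs => rw [ha]
  rw [compound_mul_oneBody_mul, mul_assoc, hg', mul_one, ← mul_assoc]

end SecondQuantization

/-! ### The differential of the compound representation -/

section Differential

variable {n : ℕ}

lemma hasDerivAt_mulVec {m k : Type*} [Finite m] [Fintype k] {A : ℝ → Matrix m k ℂ}
    {A' : Matrix m k ℂ} {x : ℝ → k → ℂ} {x' : k → ℂ} {t : ℝ}
    (hA : ∀ i j, HasDerivAt (fun s => A s i j) (A' i j) t) (hx : HasDerivAt x x' t) :
    HasDerivAt (fun s => A s *ᵥ x s) (A' *ᵥ x t + A t *ᵥ x') t := by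
  have := Fintype.ofFinite m
  refine hasDerivAt_pi.mpr fun i => ?_
  have h := HasDerivAt.fun_sum (u := Finset.univ) fun j _ =>
    (hA i j).fun_mul (hasDerivAt_pi.mp hx j)
  simpa only [Matrix.mulVec, dotProduct, Pi.add_apply, Finset.sum_add_distrib] using h

section Exp

attribute [local instance] Matrix.linftyOpNormedRing Matrix.linftyOpNormedAlgebra

lemma hasDerivAt_exp_smul_apply {ι : Type*} [Fintype ι] [DecidableEq ι] (a : Matrix ι ι ℂ)
    (i j : ι) :
    HasDerivAt (fun t : ℝ => (NormedSpace.exp (t • a) : Matrix ι ι ℂ) i j) (a i j) 0 := by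
  have h := hasDerivAt_exp_smul_const a (0 : ℝ)
  rw [zero_smul, NormedSpace.exp_zero, one_mul] at h
  exact hasDerivAt_pi.mp (hasDerivAt_pi.mp h i) j

end Exp

lemma hasDerivAt_crV_apply {v : ℝ → Fin n → ℂ} {v' : Fin n → ℂ} {t : ℝ} (hv : HasDerivAt v v' t)
    (x y : Bits n) : HasDerivAt (fun s => crV (v s) x y) (crV v' x y) t :=
  (((Matrix.entryLinearMap ℂ ℂ x y ∘ₗ crV).toContinuousLinearMap).restrictScalars
    ℝ).hasFDerivAt.comp_hasDerivAt t hv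

lemma hasDerivAt_compound_exp_mulVec (a : Matrix (Fin n) (Fin n) ℂ) (x : Bits n → ℂ) :
    HasDerivAt (fun t : ℝ => compound (NormedSpace.exp (t • a)) *ᵥ x) (oneBody a *ᵥ x) 0 := by
  induction x using fock_induction with
  | smul_vac c =>
    simp only [Matrix.mulVec_smul, compound_mulVec_vac, oneBody_mulVec_vac, smul_zero]
    exact hasDerivAt_const _ _
  | add x y hx hy =>
    simp only [Matrix.mulVec_add]
    exact hx.add hy
  | crV_mulVec u x hx =>
    have hu := hasDerivAt_mulVec (hasDerivAt_exp_smul_apply a) (hasDerivAt_const 0 u)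
    have h := hasDerivAt_mulVec (hasDerivAt_crV_apply hu) hx
    simpa only [Matrix.mulVec_mulVec, compound_mul_crV, oneBody_mul_crV, zero_smul,
      NormedSpace.exp_zero, compound_one, Matrix.mulVec_zero, Matrix.one_mulVec, add_zero,
      Matrix.add_mulVec] using h

lemma dcompound_eq_oneBody (a : Matrix (Fin n) (Fin n) ℂ) : dcompound a = oneBody a := by
  ext x y
  have h := hasDerivAt_pi.mp (hasDerivAt_compound_exp_mulVec a (Pi.single y 1)) x
  simp only [Matrix.mulVec_single_one, Matrix.col_apply] at h
  exact h.deriv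

end Differential

/-! ### The dynamical Lie algebra -/

section Generators

variable {n : ℕ} {i j : Fin n}

/-- The matrix of `su(n)` whose second quantization is `genX i j`. -/
noncomputable def suX (i j : Fin n) : Matrix (Fin n) (Fin n) ℂ :=
  Matrix.single i j (-(Complex.I / 2)) + Matrix.single j i (-(Complex.I / 2))

/-- The matrix of `su(n)` whose second quantization is `genY i j`. -/
noncomputable def suY (i j : Fin n) : Matrix (Fin n) (Fin n) ℂ :=
  Matrix.single i j (1 / 2) - Matrix.single j i (1 / 2)

/-- The matrix of `su(n)` whose second quantization is `genZ i j`. -/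
noncomputable def suZ (i j : Fin n) : Matrix (Fin n) (Fin n) ℂ :=
  Matrix.single i i (Complex.I / 2) - Matrix.single j j (Complex.I / 2)

lemma oneBody_suX (hij : i ≠ j) : oneBody (suX i j) = genX i j := by
  rw [suX, map_add, oneBody_single, oneBody_single, cr_mul_an_of_ne hij, cr_mul_an_of_ne hij.symm,
    ← pauliString_swap hij lowerMat raiseMat, genX, σx_eq, σy_eq]
  simp only [pauliString_add_left, pauliString_add_right hij, pauliString_smul_left,
    pauliString_smul_right hij]
  match_scalars <;> ring_nf <;> simp only [Complex.I_pow_three] <;> ring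

lemma oneBody_suY (hij : i ≠ j) : oneBody (suY i j) = genY i j := by
  rw [suY, map_sub, oneBody_single, oneBody_single, cr_mul_an_of_ne hij, cr_mul_an_of_ne hij.symm,
    ← pauliString_swap hij lowerMat raiseMat, genY, σx_eq, σy_eq]
  simp only [pauliString_add_left, pauliString_add_right hij, pauliString_smul_left,
    pauliString_smul_right hij]
  match_scalars <;> ring_nf <;> simp only [Complex.I_sq] <;> ring

lemma onQubit_σz (i : Fin n) : onQubit σz i = 1 + (-2 : ℂ) • (cr i * an i) := by
  rw [σz_eq, onQubit_add, onQubit_smul, onQubit_one, cr_mul_an_self]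

lemma oneBody_suZ (i j : Fin n) : oneBody (suZ i j) = genZ i j := by
  rw [suZ, map_sub, oneBody_single, oneBody_single, genZ, onQubit_σz, onQubit_σz]
  module

lemma suX_mem (hij : i ≠ j) : suX i j ∈ su n := by
  refine ⟨?_, ?_⟩
  · simp [suX, Matrix.conjTranspose_add, Matrix.conjTranspose_single, add_comm,
      ← Matrix.single_neg, div_eq_mul_inv]
  · simp [suX, Matrix.trace_add, Matrix.trace_single_eq_of_ne, hij, hij.symm]

lemma suY_mem (hij : i ≠ j) : suY i j ∈ su n := by
  refine ⟨?_, ?_⟩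
  · simp [suY, Matrix.conjTranspose_sub, Matrix.conjTranspose_single]
  · simp [suY, Matrix.trace_sub, Matrix.trace_single_eq_of_ne, hij, hij.symm]

lemma suZ_mem (i j : Fin n) : suZ i j ∈ su n := by
  refine ⟨?_, ?_⟩
  · simp [suZ, Matrix.conjTranspose_sub, Matrix.conjTranspose_single, ← Matrix.single_neg,
      div_eq_mul_inv, neg_add_eq_sub]
  · simp [suZ, Matrix.trace_sub]

lemma stdNormSq_suX (hij : i ≠ j) : stdNormSq (suX i j) = 1 / 2 := by
  norm_num [stdNormSq, suX, mul_add, add_mul, hij, hij.symm]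

lemma stdNormSq_suY (hij : i ≠ j) : stdNormSq (suY i j) = 1 / 2 := by
  norm_num [stdNormSq, suY, mul_sub, sub_mul, hij, hij.symm]

lemma stdNormSq_suZ (hij : i ≠ j) : stdNormSq (suZ i j) = 1 / 2 := by
  norm_num [stdNormSq, suZ, mul_sub, sub_mul, hij, hij.symm]

/-- The matrices of `su(n)` whose second quantizations are the generators of the ansatz. -/
def suGenerators (n : ℕ) : Set (Matrix (Fin n) (Fin n) ℂ) :=
  {a | ∃ i j : Fin n, i ≠ j ∧ (a = suX i j ∨ a = suY i j ∨ a = suZ i j)}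

lemma image_oneBody_suGenerators (n : ℕ) : oneBody '' suGenerators n = generators n := by
  ext H
  constructor
  · rintro ⟨_, ⟨i, j, hij, rfl | rfl | rfl⟩, rfl⟩
    · exact ⟨i, j, hij, .inl (oneBody_suX hij)⟩
    · exact ⟨i, j, hij, .inr (.inl (oneBody_suY hij))⟩
    · exact ⟨i, j, hij, .inr (.inr (oneBody_suZ i j))⟩
  · rintro ⟨i, j, hij, rfl | rfl | rfl⟩
    · exact ⟨_, ⟨i, j, hij, .inl rfl⟩, oneBody_suX hij⟩
    · exact ⟨_, ⟨i, j, hij, .inr (.inl rfl)⟩, oneBody_suY hij⟩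
    · exact ⟨_, ⟨i, j, hij, .inr (.inr rfl)⟩, oneBody_suZ i j⟩

lemma mem_su_of_mem_suGenerators {a : Matrix (Fin n) (Fin n) ℂ} (ha : a ∈ suGenerators n) :
    a ∈ su n := by
  obtain ⟨i, j, hij, rfl | rfl | rfl⟩ := ha
  exacts [suX_mem hij, suY_mem hij, suZ_mem i j]

lemma stdNormSq_of_mem_suGenerators {a : Matrix (Fin n) (Fin n) ℂ} (ha : a ∈ suGenerators n) :
    stdNormSq a = 1 / 2 := by
  obtain ⟨i, j, hij, rfl | rfl | rfl⟩ := ha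
  exacts [stdNormSq_suX hij, stdNormSq_suY hij, stdNormSq_suZ hij]

lemma exists_su_of_mem_generators {H : QOp n} (hH : H ∈ generators n) :
    ∃ h ∈ su n, dcompound h = H ∧ stdNormSq h = 1 / 2 := by
  rw [← image_oneBody_suGenerators] at hH
  obtain ⟨h, hh, rfl⟩ := hH
  exact ⟨h, mem_su_of_mem_suGenerators hh, dcompound_eq_oneBody h, stdNormSq_of_mem_suGenerators hh⟩

end Generators

section Span

variable {n : ℕ}

/-- `su(n)` as a real subspace of the complex matrices. -/
def suSubmodule (n : ℕ) : Submodule ℝ (Matrix (Fin n) (Fin n) ℂ) where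
  carrier := su n
  add_mem' := by
    rintro a b ⟨ha, ha'⟩ ⟨hb, hb'⟩
    exact ⟨by rw [Matrix.conjTranspose_add, ha, hb, neg_add], by simp [ha', hb']⟩
  zero_mem' := by constructor <;> simp
  smul_mem' := by
    rintro c a ⟨ha, ha'⟩
    exact ⟨by simp [Matrix.conjTranspose_smul, ha], by simp [ha']⟩

lemma re_smul_suY_sub_im_smul_suX (z : ℂ) (i j : Fin n) :
    z.re • suY i j - z.im • suX i j =
      (1 / 2 : ℝ) • (Matrix.single i j z - Matrix.single j i (star z)) := by
  ext k l
  simp only [suX, suY, Matrix.sub_apply, Matrix.add_apply, Matrix.smul_apply, Matrix.single_apply]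
  split_ifs <;> apply Complex.ext <;> simp <;> ring

lemma sum_re_smul_suY_sub_im_smul_suX {a : Matrix (Fin n) (Fin n) ℂ} (ha : aᴴ = -a) :
    ∑ i, ∑ j, ((a i j).re • suY i j - (a i j).im • suX i j) = a := by
  have hstar : ∑ i, ∑ j, Matrix.single j i (star (a i j)) = aᴴ := by
    rw [Finset.sum_comm]
    exact (Matrix.matrix_eq_sum_single aᴴ).symm
  simp only [re_smul_suY_sub_im_smul_suX, ← Finset.smul_sum, Finset.sum_sub_distrib]
  rw [hstar, ← Matrix.matrix_eq_sum_single, ha, sub_neg_eq_add, smul_add, ← add_smul]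
  norm_num

lemma sum_smul_suX_self {c : Fin n → ℝ} (hc : ∑ i, c i = 0) (o : Fin n) :
    ∑ i, c i • suX i i = ∑ i, (c i * -2) • suZ i o := by
  have h (i : Fin n) : suX i i = suX o o + (-2 : ℝ) • suZ i o := by
    ext k l
    simp only [suX, suZ, Matrix.sub_apply, Matrix.add_apply, Matrix.smul_apply, Matrix.single_apply]
    split_ifs <;> apply Complex.ext <;> simp <;> ring
  rw [Finset.sum_congr rfl fun i _ => congrArg (c i • ·) (h i)]
  simp only [smul_add, Finset.sum_add_distrib, ← Finset.sum_smul, hc, zero_smul, zero_add,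
    smul_smul]

lemma suSubmodule_le_span (n : ℕ) : suSubmodule n ≤ Submodule.span ℝ (suGenerators n) := by
  rintro a ⟨ha, htr⟩
  set S := Submodule.span ℝ (suGenerators n)
  have hX {i j : Fin n} (h : i ≠ j) : suX i j ∈ S := Submodule.subset_span ⟨i, j, h, .inl rfl⟩
  have hY (i j : Fin n) : suY i j ∈ S := by
    rcases eq_or_ne i j with rfl | h
    · simp [suY]
    · exact Submodule.subset_span ⟨i, j, h, .inr (.inl rfl)⟩
  have hZ (i j : Fin n) : suZ i j ∈ S := by
    rcases eq_or_ne i j with rfl | h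
    · simp [suZ]
    · exact Submodule.subset_span ⟨i, j, h, .inr (.inr rfl)⟩
  have hdiag : ∑ i, (a i i).im • suX i i ∈ S := by
    rcases isEmpty_or_nonempty (Fin n) with _ | ⟨⟨o⟩⟩
    · simp
    have him : ∑ i, (a i i).im = 0 := by simpa [Matrix.trace] using congrArg Complex.im htr
    rw [sum_smul_suX_self him o]
    exact S.sum_mem fun i _ => S.smul_mem _ (hZ i o)
  have hoff (i : Fin n) : ∑ j ∈ Finset.univ.erase i, (a i j).im • suX i j ∈ S :=
    S.sum_mem fun j hj => S.smul_mem _ (hX (Finset.ne_of_mem_erase hj).symm)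
  rw [← sum_re_smul_suY_sub_im_smul_suX ha]
  simp only [Finset.sum_sub_distrib]
  refine S.sub_mem (S.sum_mem fun i _ => S.sum_mem fun j _ => S.smul_mem _ (hY i j)) ?_
  rw [Finset.sum_congr rfl fun i _ => (Finset.add_sum_erase _ _ (Finset.mem_univ i)).symm,
    Finset.sum_add_distrib]
  exact S.add_mem hdiag (S.sum_mem fun i _ => hoff i)

lemma lie_mem_su {a b : Matrix (Fin n) (Fin n) ℂ} (ha : a ∈ su n) (hb : b ∈ su n) :
    ⁅a, b⁆ ∈ su n := by
  refine ⟨?_, ?_⟩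
  · rw [Ring.lie_def, Matrix.conjTranspose_sub, Matrix.conjTranspose_mul, Matrix.conjTranspose_mul,
      ha.1, hb.1]
    noncomm_ring
  · exact LieAlgebra.matrix_trace_commutator_zero _ _ _ _

/-- The second quantization of `su(n)` as a real Lie algebra of `n`-qubit operators. -/
noncomputable def suImage (n : ℕ) : LieSubalgebra ℝ (QOp n) where
  toSubmodule := (suSubmodule n).map (oneBody.restrictScalars ℝ)
  lie_mem' := by
    rintro _ _ ⟨a, ha, rfl⟩ ⟨b, hb, rfl⟩
    exact ⟨⁅a, b⁆, lie_mem_su ha hb, (oneBody_lie a b).symm⟩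

lemma dla_eq_suImage (n : ℕ) : dla n = suImage n := by
  rw [dla, ← image_oneBody_suGenerators]
  apply le_antisymm
  · refine LieSubalgebra.lieSpan_le.mpr ?_
    exact Set.image_mono fun a => mem_su_of_mem_suGenerators
  · rintro _ ⟨a, ha, rfl⟩
    have h := Submodule.mem_map_of_mem (f := oneBody.restrictScalars ℝ) (suSubmodule_le_span n ha)
    rw [Submodule.map_span] at h
    exact LieSubalgebra.submodule_span_le_lieSpan h

lemma coe_dla (n : ℕ) : (dla n : Set (QOp n)) = dcompound '' su n := by
  rw [dla_eq_suImage, funext dcompound_eq_oneBody]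
  rfl

end Span

section Dimension

/-- Multiplication by `i` identifies the self-adjoint with the skew-adjoint elements. -/
noncomputable def selfAdjointEquivSkewAdjoint (A : Type*) [AddCommGroup A] [Module ℂ A]
    [StarAddMonoid A] [StarModule ℂ A] : selfAdjoint A ≃ₗ[ℝ] skewAdjoint A where
  toFun a := ⟨Complex.I • (a : A), by
    rw [skewAdjoint.mem_iff, star_smul, selfAdjoint.mem_iff.mp a.2]; simp⟩
  invFun a := ⟨(-Complex.I) • (a : A), by
    rw [selfAdjoint.mem_iff, star_smul, skewAdjoint.mem_iff.mp a.2]; simp⟩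
  map_add' a b := by ext1; simp
  map_smul' c a := Subtype.ext (smul_comm _ _ _)
  left_inv a := by ext1; simp [smul_smul]
  right_inv a := by ext1; simp [smul_smul]

lemma finrank_skewAdjoint (A : Type*) [AddCommGroup A] [Module ℂ A] [FiniteDimensional ℂ A]
    [StarAddMonoid A] [StarModule ℂ A] :
    Module.finrank ℝ (skewAdjoint.submodule ℝ A) = Module.finrank ℂ A := by
  have : Module.Finite ℝ A := Module.Finite.trans ℂ A
  have hA := (StarModule.decomposeProdAdjoint ℝ A).finrank_eq
  have : Module.Finite ℝ (skewAdjoint A) :=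
    inferInstanceAs (Module.Finite ℝ (skewAdjoint.submodule ℝ A))
  have : Module.Finite ℝ (selfAdjoint A) :=
    inferInstanceAs (Module.Finite ℝ (selfAdjoint.submodule ℝ A))
  rw [Module.finrank_prod, (selfAdjointEquivSkewAdjoint A).finrank_eq,
    finrank_real_of_complex, ← two_mul] at hA
  exact (Nat.eq_of_mul_eq_mul_left two_pos hA).symm

variable {n : ℕ}

/-- The imaginary part of the trace of a skew-Hermitian matrix. Its kernel is `su(n)`. -/
noncomputable def imTrace (n : ℕ) :
    skewAdjoint.submodule ℝ (Matrix (Fin n) (Fin n) ℂ) →ₗ[ℝ] ℝ :=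
  Complex.imLm ∘ₗ (Matrix.traceLinearMap (Fin n) ℝ ℂ) ∘ₗ
    (skewAdjoint.submodule ℝ (Matrix (Fin n) (Fin n) ℂ)).subtype

lemma map_ker_imTrace (n : ℕ) :
    (LinearMap.ker (imTrace n)).map (skewAdjoint.submodule ℝ _).subtype = suSubmodule n := by
  ext a
  constructor
  · rintro ⟨⟨b, hb⟩, him, rfl⟩
    have hre := congrArg (fun m => (Matrix.trace m).re) (show bᴴ = -b from hb)
    simp only [Matrix.trace_conjTranspose, Matrix.trace_neg, Complex.star_def, Complex.conj_re,
      Complex.neg_re] at hre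
    exact ⟨hb, Complex.ext (self_eq_neg.mp hre) him⟩
  · rintro ⟨ha, htr⟩
    exact ⟨⟨a, ha⟩, by simp [imTrace, htr], rfl⟩

lemma imTrace_surjective (o : Fin n) : Function.Surjective (imTrace n) := by
  intro r
  refine ⟨⟨Matrix.single o o (r * Complex.I), ?_⟩, by simp [imTrace]⟩
  change (Matrix.single o o (r * Complex.I))ᴴ = _
  simp [Matrix.conjTranspose_single, ← Matrix.single_neg]

lemma finrank_suSubmodule (hn : n ≠ 0) : Module.finrank ℝ (suSubmodule n) = n ^ 2 - 1 := by
  have h := LinearMap.finrank_range_add_finrank_ker (imTrace n)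
  rw [LinearMap.range_eq_top.mpr (imTrace_surjective ⟨0, Nat.pos_of_ne_zero hn⟩), finrank_top,
    Module.finrank_self, ← Submodule.finrank_map_subtype_eq, map_ker_imTrace, finrank_skewAdjoint,
    Module.finrank_matrix, Module.finrank_self, Fintype.card_fin, mul_one, ← sq] at h
  exact Nat.eq_sub_of_add_eq' h

lemma finrank_dla (hn : n ≠ 0) : Module.finrank ℝ (dla n) = n ^ 2 - 1 := by
  rw [dla_eq_suImage, ← finrank_suSubmodule hn]
  exact (Submodule.equivMapOfInjective (oneBody.restrictScalars ℝ) oneBody_injective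
    (suSubmodule n)).finrank_eq.symm

end Dimension

/-! ### Unitarily invariant bilinear forms on matrices -/

lemma natCast_sq_sub_one_ne_zero {n : ℕ} (hn : 1 < n) : (n : ℂ) ^ 2 - 1 ≠ 0 := by
  rw [sub_ne_zero]
  exact_mod_cast (Nat.one_lt_pow two_ne_zero hn).ne'

section InvariantForms

variable {ι : Type*} [Fintype ι] [DecidableEq ι]

/-- The adjoint action `x ↦ u x u†` of a unitary matrix. -/
noncomputable def Ad : Matrix.unitaryGroup ι ℂ →* (Matrix ι ι ℂ ≃⋆ₐ[ℂ] Matrix ι ι ℂ) :=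
  Unitary.conjStarAlgAut ℂ (Matrix ι ι ℂ)

lemma Ad_apply (u : Matrix.unitaryGroup ι ℂ) (x : Matrix ι ι ℂ) : Ad u x = u.1 * x * u.1ᴴ := rfl

lemma trace_Ad (u : Matrix.unitaryGroup ι ℂ) (x : Matrix ι ι ℂ) : (Ad u x).trace = x.trace := by
  rw [Ad_apply, Matrix.trace_mul_comm, ← mul_assoc, ← Matrix.star_eq_conjTranspose,
    Unitary.coe_star_mul_self, one_mul]

/-- A bilinear form on matrices is unitarily invariant if the adjoint action preserves it. -/
def IsUnitarilyInvariant (B : LinearMap.BilinForm ℂ (Matrix ι ι ℂ)) : Prop :=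
  ∀ u P Q, B (Ad u P) (Ad u Q) = B P Q

/-- The diagonal unitary with entry `i` at position `p` and `1` elsewhere. -/
noncomputable def phaseUnitary (p : ι) : Matrix.unitaryGroup ι ℂ :=
  ⟨Matrix.diagonal (Pi.mulSingle p Complex.I), by
    rw [Matrix.mem_unitaryGroup_iff, Matrix.star_eq_conjTranspose, Matrix.diagonal_conjTranspose,
      Matrix.diagonal_mul_diagonal, ← Matrix.diagonal_one]
    congr 1
    funext k
    rcases eq_or_ne k p with rfl | h <;> simp [*]⟩

/-- The permutation matrix of `σ` as a unitary. -/
def permUnitary (σ : Equiv.Perm ι) : Matrix.unitaryGroup ι ℂ :=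
  ⟨σ.permMatrix ℂ, by
    rw [Matrix.mem_unitaryGroup_iff, Matrix.star_eq_conjTranspose, Matrix.conjTranspose_permMatrix,
      ← Matrix.permMatrix_mul, inv_mul_cancel, Matrix.permMatrix_one]⟩

/-- The square root `(1 + i)/2 + (1 - i)/2 • S` of the permutation matrix `S` of the transposition
of `i` and `j`. -/
noncomputable def sqrtSwapUnitary (i j : ι) : Matrix.unitaryGroup ι ℂ :=
  ⟨((1 + Complex.I) / 2) • 1 + ((1 - Complex.I) / 2) • (Equiv.swap i j).permMatrix ℂ, by
    have hS : (Equiv.swap i j).permMatrix ℂ * (Equiv.swap i j).permMatrix ℂ = 1 := by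
      rw [← Matrix.permMatrix_mul, Equiv.swap_mul_self, Matrix.permMatrix_one]
    rw [Matrix.mem_unitaryGroup_iff, Matrix.star_eq_conjTranspose, Matrix.conjTranspose_add,
      Matrix.conjTranspose_smul, Matrix.conjTranspose_smul, Matrix.conjTranspose_one,
      Matrix.conjTranspose_permMatrix, Equiv.swap_inv, add_mul, mul_add, mul_add]
    simp only [smul_mul_smul_comm, one_mul, mul_one, hS]
    match_scalars <;> simp <;> ring_nf <;> norm_num⟩

lemma Ad_phaseUnitary_single (p i j : ι) :
    Ad (phaseUnitary p) (Matrix.single i j 1) =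
      ((Pi.mulSingle p Complex.I : ι → ℂ) i * star ((Pi.mulSingle p Complex.I : ι → ℂ) j)) •
        Matrix.single i j (1 : ℂ) := by
  simp only [Ad_apply, phaseUnitary, Matrix.diagonal_conjTranspose]
  ext k l
  rw [Matrix.mul_diagonal, Matrix.diagonal_mul, Matrix.smul_apply, Matrix.single_apply]
  split_ifs with h
  · simp [h.1, h.2]
  · simp

lemma Ad_permUnitary_single (σ : Equiv.Perm ι) (i j : ι) :
    Ad (permUnitary σ) (Matrix.single (σ i) (σ j) 1) = Matrix.single i j 1 := by
  simp only [Ad_apply, permUnitary, Matrix.conjTranspose_permMatrix]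
  ext k l
  simp [← Equiv.Perm.inv_def, PEquiv.toMatrix_toPEquiv_mul, PEquiv.mul_toMatrix_toPEquiv,
    Matrix.single_apply]

lemma Ad_sqrtSwapUnitary_single (i j : ι) :
    Ad (sqrtSwapUnitary i j) (Matrix.single i i 1) =
      (1 / 2 : ℂ) • (Matrix.single i i 1 + Matrix.single j j 1 +
        Complex.I • (Matrix.single i j 1 - Matrix.single j i 1)) := by
  have hi (k : ι) : i = Equiv.swap i j k ↔ j = k := by
    rw [eq_comm, Equiv.swap_apply_eq_iff, Equiv.swap_apply_left, eq_comm]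
  have hl : (Equiv.swap i j).permMatrix ℂ * Matrix.single i i 1 = Matrix.single j i 1 := by
    ext k l
    simp [PEquiv.toMatrix_toPEquiv_mul, Matrix.single_apply, hi]
  have hr (k : ι) : Matrix.single k i 1 * (Equiv.swap i j).permMatrix ℂ = Matrix.single k j 1 := by
    ext l m
    simp [PEquiv.mul_toMatrix_toPEquiv, Matrix.single_apply, hi]
  simp only [Ad_apply, sqrtSwapUnitary, Matrix.conjTranspose_add, Matrix.conjTranspose_smul,
    Matrix.conjTranspose_one, Matrix.conjTranspose_permMatrix, Equiv.swap_inv, add_mul, mul_add,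
    smul_mul_assoc, mul_smul_comm, one_mul, mul_one, hl, hr]
  match_scalars <;> simp <;> ring_nf <;> norm_num

lemma trace_single_one (i j : ι) :
    (Matrix.single i j (1 : ℂ)).trace = if i = j then 1 else 0 := by
  split_ifs with h
  · rw [h, Matrix.trace_single_eq_same]
  · rw [Matrix.trace_single_eq_of_ne _ _ _ h]

namespace IsUnitarilyInvariant

variable {B : LinearMap.BilinForm ℂ (Matrix ι ι ℂ)}

lemma single_single_eq_zero (hB : IsUnitarilyInvariant B) {i j k l : ι} (h₁ : ¬(i = j ∧ k = l))
    (h₂ : ¬(i = l ∧ j = k)) : B (Matrix.single i j 1) (Matrix.single k l 1) = 0 := by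
  by_contra h₀
  have h (p : ι) := hB (phaseUnitary p) (Matrix.single i j 1) (Matrix.single k l 1)
  simp only [Ad_phaseUnitary_single, map_smul, LinearMap.smul_apply, smul_eq_mul, ← mul_assoc,
    mul_eq_right₀ h₀, Pi.mulSingle_apply] at h
  have hI : Complex.I ≠ 1 := fun h => by simpa using congrArg Complex.re h
  rcases eq_or_ne i j with rfl | hij
  · have hkl : l ≠ k := fun e => h₁ ⟨rfl, e.symm⟩
    have hk := h k
    rcases eq_or_ne i k with rfl | hik <;> simp [*] at hk
  · rcases eq_or_ne i l with rfl | hil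
    · have hjk : j ≠ k := fun e => h₂ ⟨rfl, e⟩
      have hk := h k
      rcases eq_or_ne i k with rfl | hik <;> simp [*] at hk
    · have hi := h i
      rcases eq_or_ne k i with rfl | hik <;> norm_num [hij.symm, hil.symm, *] at hi

lemma single_single_map (hB : IsUnitarilyInvariant B) (σ : Equiv.Perm ι) (i j k l : ι) :
    B (Matrix.single (σ i) (σ j) 1) (Matrix.single (σ k) (σ l) 1) =
      B (Matrix.single i j 1) (Matrix.single k l 1) := by
  rw [← hB (permUnitary σ), Ad_permUnitary_single, Ad_permUnitary_single]

lemma single_single_self (hB : IsUnitarilyInvariant B) {i j : ι} (hij : i ≠ j) :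
    B (Matrix.single i i 1) (Matrix.single i i 1) =
      B (Matrix.single i i 1) (Matrix.single j j 1) +
        B (Matrix.single i j 1) (Matrix.single j i 1) := by
  have h := hB (sqrtSwapUnitary i j) (Matrix.single i i 1) (Matrix.single i i 1)
  have hswap := hB.single_single_map (Equiv.swap i j)
  have hjj := hswap i i i i
  have hji := hswap i i j j
  have hq := hswap i j j i
  simp only [Equiv.swap_apply_left, Equiv.swap_apply_right] at hjj hji hq
  simp only [Ad_sqrtSwapUnitary_single, map_smul, map_add, map_sub, LinearMap.smul_apply,
    LinearMap.add_apply, LinearMap.sub_apply, smul_eq_mul, hjj, hji, hq] at h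
  simp only [hB.single_single_eq_zero, hij, hij.symm, and_self, and_true, and_false,
    not_false_eq_true, add_zero, zero_add, sub_zero, zero_sub, mul_zero] at h
  linear_combination -2 * h - B (Matrix.single i j 1) (Matrix.single j i 1) * Complex.I_sq

variable [Nontrivial ι]

theorem exists_eq_trace (hB : IsUnitarilyInvariant B) :
    ∃ α β : ℂ, ∀ P Q, B P Q = α * (P * Q).trace + β * (P.trace * Q.trace) := by
  obtain ⟨i₀, j₀, h₀⟩ := exists_pair_ne ι
  have htrans {i j : ι} (hij : i ≠ j) : ∃ σ : Equiv.Perm ι, σ i₀ = i ∧ σ j₀ = j :=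
    MulAction.is_two_pretransitive_iff.mp (Equiv.Perm.isMultiplyPretransitive ι 2) h₀ hij
  set α := B (Matrix.single i₀ j₀ 1) (Matrix.single j₀ i₀ 1) with hα
  set β := B (Matrix.single i₀ i₀ 1) (Matrix.single j₀ j₀ 1) with hβ
  have hne (i j : ι) (hij : i ≠ j) : B (Matrix.single i j 1) (Matrix.single j i 1) = α ∧
      B (Matrix.single i i 1) (Matrix.single j j 1) = β := by
    obtain ⟨σ, rfl, rfl⟩ := htrans hij
    exact ⟨hB.single_single_map σ _ _ _ _, hB.single_single_map σ _ _ _ _⟩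
  have hself (i : ι) : B (Matrix.single i i 1) (Matrix.single i i 1) = α + β := by
    obtain ⟨j, hij⟩ := exists_ne i
    rw [hB.single_single_self hij.symm, (hne i j hij.symm).1, (hne i j hij.symm).2, add_comm]
  let tr := Matrix.traceLinearMap ι ℂ ℂ
  suffices B = α • (LinearMap.mul ℂ _).compr₂ tr + β • LinearMap.BilinForm.linMulLin tr tr from
    ⟨α, β, fun P Q => by rw [this]; rfl⟩
  refine LinearMap.BilinForm.ext_basis (Matrix.stdBasis ℂ ι ι) fun ⟨i, j⟩ ⟨k, l⟩ => ?_
  rw [Matrix.stdBasis_eq_single, Matrix.stdBasis_eq_single]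
  change _ = α * (Matrix.single i j (1 : ℂ) * Matrix.single k l 1).trace +
    β * ((Matrix.single i j (1 : ℂ)).trace * (Matrix.single k l (1 : ℂ)).trace)
  rw [Matrix.trace_single_mul, one_smul, Matrix.single_apply, trace_single_one, trace_single_one]
  by_cases h₁ : i = j ∧ k = l
  · obtain ⟨rfl, rfl⟩ := h₁
    rcases eq_or_ne i k with rfl | hik
    · simp [hself]
    · simp [hik.symm, (hne i k hik).2]
  · by_cases h₂ : i = l ∧ j = k
    · obtain ⟨rfl, rfl⟩ := h₂
      have hij : i ≠ j := fun e => h₁ ⟨e, e.symm⟩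
      simp [hij, (hne i j hij).1]
    · rw [hB.single_single_eq_zero h₁ h₂, if_neg (by tauto), ite_zero_mul_ite_zero, if_neg h₁]
      simp

theorem eq_of_apply_one_one (hB : IsUnitarilyInvariant B) (h₁ : B 1 1 = 0) (P Q : Matrix ι ι ℂ) :
    B P Q = (∑ i, ∑ j, B (Matrix.single i j 1) (Matrix.single j i 1)) /
      ((Fintype.card ι : ℂ) ^ 2 - 1) * ((P * Q).trace - P.trace * Q.trace / Fintype.card ι) := by
  obtain ⟨α, β, h⟩ := hB.exists_eq_trace
  have hn : (Fintype.card ι : ℂ) ≠ 0 := Nat.cast_ne_zero.mpr Fintype.card_ne_zero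
  have hn1 := natCast_sq_sub_one_ne_zero (Fintype.one_lt_card (α := ι))
  have hβ : β = -α / Fintype.card ι := by
    rw [h, mul_one, Matrix.trace_one] at h₁
    rw [eq_div_iff hn]
    exact mul_right_cancel₀ hn (by linear_combination h₁)
  have hsum : ∑ i, ∑ j, B (Matrix.single i j 1) (Matrix.single j i 1) =
      α * ((Fintype.card ι : ℂ) ^ 2 - 1) := by
    simp [h, hβ, trace_single_one, Finset.sum_add_distrib]
    field_simp
    ring
  rw [hsum, mul_div_cancel_right₀ _ hn1, h, hβ]
  ring

end IsUnitarilyInvariant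

end InvariantForms

/-! ### Haar averages over adjoint orbits -/

open MeasureTheory

section Haar

variable {n : ℕ}

instance instIsProbabilityMeasureHaarSU (n : ℕ) : IsProbabilityMeasure (haarSU n) :=
  ⟨Measure.haarMeasure_self (K₀ := ⊤)⟩

instance instIsMulLeftInvariantHaarSU (n : ℕ) : (haarSU n).IsMulLeftInvariant :=
  inferInstanceAs
    (Measure.haarMeasure (⊤ : TopologicalSpace.PositiveCompacts (SUn n))).IsMulLeftInvariant

instance instSecondCountableTopologySUn (n : ℕ) : SecondCountableTopology (SUn n) :=
  have : SecondCountableTopology (Matrix (Fin n) (Fin n) ℂ) :=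
    inferInstanceAs (SecondCountableTopology (Fin n → Fin n → ℂ))
  TopologicalSpace.Subtype.secondCountableTopology _

/-- The inclusion of `SU(n)` into the unitary group. -/
def suToUnitary (n : ℕ) : SUn n →* Matrix.unitaryGroup (Fin n) ℂ :=
  Submonoid.inclusion Matrix.specialUnitaryGroup_le_unitaryGroup

/-- The adjoint orbit map `g ↦ g a g†`. -/
noncomputable abbrev orbit (a : Matrix (Fin n) (Fin n) ℂ) (g : SUn n) : Matrix (Fin n) (Fin n) ℂ :=
  Ad (suToUnitary n g) a

lemma orbit_apply (a : Matrix (Fin n) (Fin n) ℂ) (g : SUn n) : orbit a g = g.1 * a * g.1ᴴ := rfl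

lemma continuous_orbit (a : Matrix (Fin n) (Fin n) ℂ) : Continuous (orbit a) := by
  simp only [funext (orbit_apply a)]
  fun_prop

lemma integrable_haarSU {f : SUn n → ℂ} (hf : Continuous f) : Integrable f (haarSU n) :=
  hf.integrable_of_hasCompactSupport (HasCompactSupport.of_compactSpace f)

lemma exists_smul_specialUnitary (hn : n ≠ 0) (u : Matrix.unitaryGroup (Fin n) ℂ) :
    ∃ z : ℂ, ∃ s : SUn n, z * star z = 1 ∧ u.1 = z • s.1 := by
  obtain ⟨z, hz⟩ := IsAlgClosed.exists_pow_nat_eq u.1.det (Nat.pos_of_ne_zero hn)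
  have hz_norm : ‖z‖ = 1 := by
    rw [← pow_eq_one_iff_of_nonneg (norm_nonneg z) hn, ← norm_pow, hz]
    exact CStarRing.norm_of_mem_unitary (Matrix.det_of_mem_unitary u.2)
  have hzz : z * star z = 1 := by simp [Complex.mul_conj, Complex.normSq_eq_norm_sq, hz_norm]
  refine ⟨z, ⟨star z • u.1, Matrix.mem_specialUnitaryGroup_iff.mpr ⟨?_, ?_⟩⟩, hzz, ?_⟩
  · rw [Matrix.mem_unitaryGroup_iff, star_smul, star_star, smul_mul_smul_comm,
      Matrix.mem_unitaryGroup_iff.mp u.2, mul_comm, hzz, one_smul]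
  · rw [Matrix.det_smul, Fintype.card_fin, ← hz, ← mul_pow, mul_comm, hzz, one_pow]
  · rw [smul_smul, hzz, one_smul]

-- Phases act trivially by conjugation, so invariance under `SU(n)` is invariance under `U(n)`.
lemma integral_Ad_orbit (hn : n ≠ 0) (u : Matrix.unitaryGroup (Fin n) ℂ)
    (a : Matrix (Fin n) (Fin n) ℂ) (F : Matrix (Fin n) (Fin n) ℂ → ℂ) :
    ∫ g, F (Ad u (orbit a g)) ∂haarSU n = ∫ g, F (orbit a g) ∂haarSU n := by
  obtain ⟨z, s, hz, hu⟩ := exists_smul_specialUnitary hn u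
  have hAd : Ad u = Ad (suToUnitary n s) := by
    ext1 x
    rw [Ad_apply, hu, Matrix.conjTranspose_smul, smul_mul_assoc, smul_mul_smul_comm, hz, one_smul]
    rfl
  rw [hAd, ← integral_mul_left_eq_self (fun g => F (orbit a g)) s]
  simp only [orbit, map_mul, StarAlgEquiv.mul_apply]

theorem integral_bilinForm_orbit (hn : 1 < n)
    {b : Matrix (Fin n) (Fin n) ℂ → LinearMap.BilinForm ℂ (Matrix (Fin n) (Fin n) ℂ)}
    (hcont : ∀ P Q, Continuous fun x => b x P Q)
    (hequiv : ∀ u x P Q, b (Ad u x) (Ad u P) (Ad u Q) = b x P Q)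
    {a : Matrix (Fin n) (Fin n) ℂ} (hone : b a 1 1 = 0) {c : ℂ}
    (hc : ∀ g, ∑ i, ∑ j, b (orbit a g) (Matrix.single i j 1) (Matrix.single j i 1) = c)
    (P Q : Matrix (Fin n) (Fin n) ℂ) :
    ∫ g, b (orbit a g) P Q ∂haarSU n =
      c / ((n : ℂ) ^ 2 - 1) * ((P * Q).trace - P.trace * Q.trace / n) := by
  have : Nontrivial (Fin n) := Fin.nontrivial_iff_two_le.mpr hn
  have hint (P Q) : Integrable (fun g => b (orbit a g) P Q) (haarSU n) :=
    integrable_haarSU ((hcont P Q).comp (continuous_orbit a))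
  let B : LinearMap.BilinForm ℂ (Matrix (Fin n) (Fin n) ℂ) :=
    LinearMap.mk₂ ℂ (fun P Q => ∫ g, b (orbit a g) P Q ∂haarSU n)
      (fun P P' Q => by simp [integral_add (hint P Q) (hint P' Q)])
      (fun z P Q => by simp [integral_const_mul])
      (fun P Q Q' => by simp [integral_add (hint P Q) (hint P Q')])
      (fun z P Q => by simp [integral_const_mul])
  have hB : IsUnitarilyInvariant B := fun u P Q => by
    change ∫ g, b (orbit a g) (Ad u P) (Ad u Q) ∂haarSU n = ∫ g, b (orbit a g) P Q ∂haarSU n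
    rw [← integral_Ad_orbit hn.ne_bot u a fun x => b x (Ad u P) (Ad u Q)]
    simp only [hequiv]
  have hB_one : B 1 1 = 0 := by
    have h (g : SUn n) : b (orbit a g) 1 1 = 0 := by
      simpa only [map_one, hone] using hequiv (suToUnitary n g) a 1 1
    simp [B, h]
  have hB_sum : ∑ i, ∑ j, B (Matrix.single i j 1) (Matrix.single j i 1) = c := by
    simp only [B, LinearMap.mk₂_apply]
    simp_rw [← integral_finsetSum _ fun _ _ => hint _ _]
    rw [← integral_finsetSum _ fun _ _ => integrable_finsetSum _ fun _ _ => hint _ _]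
    simp [hc]
  have := hB.eq_of_apply_one_one hB_one P Q
  rwa [hB_sum, Fintype.card_fin] at this

lemma trace_orbit (a : Matrix (Fin n) (Fin n) ℂ) (g : SUn n) : (orbit a g).trace = a.trace :=
  trace_Ad _ a

lemma trace_orbit_mul_orbit (a b : Matrix (Fin n) (Fin n) ℂ) (g : SUn n) :
    (orbit a g * orbit b g).trace = (a * b).trace := by
  rw [orbit, orbit, ← map_mul, trace_Ad]

lemma integral_trace_mul_orbit_mul_trace_mul_orbit (hn : 1 < n) {a : Matrix (Fin n) (Fin n) ℂ}
    (ha : a.trace = 0) (P Q : Matrix (Fin n) (Fin n) ℂ) :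
    ∫ g, (P * orbit a g).trace * (Q * orbit a g).trace ∂haarSU n =
      (a * a).trace / ((n : ℂ) ^ 2 - 1) * ((P * Q).trace - P.trace * Q.trace / n) := by
  let tr (x) := Matrix.traceLinearMap (Fin n) ℂ ℂ ∘ₗ LinearMap.mulRight ℂ x
  refine integral_bilinForm_orbit hn (b := fun x => LinearMap.BilinForm.linMulLin (tr x) (tr x))
    (fun P Q => ?_) (fun u x P Q => ?_) ?_ (fun g => ?_) P Q
  · change Continuous fun x => (P * x).trace * (Q * x).trace
    fun_prop
  · change (Ad u P * Ad u x).trace * (Ad u Q * Ad u x).trace = (P * x).trace * (Q * x).trace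
    simp only [← map_mul, trace_Ad]
  · change (1 * a).trace * (1 * a).trace = 0
    rw [one_mul, ha, zero_mul]
  · change ∑ i, ∑ j, (Matrix.single i j (1 : ℂ) * orbit a g).trace *
      (Matrix.single j i (1 : ℂ) * orbit a g).trace = _
    rw [← trace_orbit_mul_orbit a a g, Matrix.trace, Finset.sum_comm]
    simp only [Matrix.trace_single_mul, one_smul, Matrix.diag_apply, Matrix.mul_apply]

lemma integral_trace_mul_orbit (hn : 1 < n) {a : Matrix (Fin n) (Fin n) ℂ} (ha : a.trace = 0)
    (P : Matrix (Fin n) (Fin n) ℂ) : ∫ g, (P * orbit a g).trace ∂haarSU n = 0 := by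
  let tr (x) := Matrix.traceLinearMap (Fin n) ℂ ℂ ∘ₗ LinearMap.mulRight ℂ x
  have h := integral_bilinForm_orbit hn (c := 0) (a := a)
    (b := fun x => LinearMap.BilinForm.linMulLin (tr x) (tr 1))
    (fun P Q => ?_) (fun u x P Q => ?_) ?_ (fun g => ?_) P 1
  · change ∫ g, (P * orbit a g).trace *
      ((1 : Matrix (Fin n) (Fin n) ℂ) * 1).trace ∂haarSU n = _ at h
    simpa [integral_mul_const, (Nat.zero_lt_of_lt hn).ne'] using h
  · change Continuous fun x => (P * x).trace * (Q * 1).trace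
    fun_prop
  · change (Ad u P * Ad u x).trace * (Ad u Q * 1).trace = (P * x).trace * (Q * 1).trace
    simp only [← map_mul, mul_one, trace_Ad]
  · change (1 * a).trace * _ = 0
    rw [one_mul, ha, zero_mul]
  · change ∑ i, ∑ j, (Matrix.single i j (1 : ℂ) * orbit a g).trace *
      (Matrix.single j i (1 : ℂ) * 1).trace = 0
    simp only [Matrix.trace_single_mul, one_smul, mul_one, trace_single_one, mul_ite, mul_zero,
      Finset.sum_ite_eq', Finset.mem_univ, if_true]
    exact (trace_orbit a g).trans ha

lemma sum_trace_lie_single_mul_lie_single (x : Matrix (Fin n) (Fin n) ℂ) :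
    ∑ i : Fin n, ∑ j : Fin n,
        (⁅Matrix.single i j (1 : ℂ), x⁆ * ⁅Matrix.single j i (1 : ℂ), x⁆).trace =
      2 * x.trace ^ 2 - 2 * n * (x * x).trace := by
  have h (i j : Fin n) : (⁅Matrix.single i j (1 : ℂ), x⁆ * ⁅Matrix.single j i (1 : ℂ), x⁆).trace =
      2 * (x i i * x j j) - (x * x) i i - (x * x) j j := by
    set E := Matrix.single i j (1 : ℂ) with hE
    set F := Matrix.single j i (1 : ℂ) with hF
    have hExF (y : Matrix (Fin n) (Fin n) ℂ) : E * y * F = y j j • Matrix.single i i 1 := by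
      rw [hE, hF, Matrix.single_mul_mul_single, one_mul, mul_one, Matrix.smul_single, smul_eq_mul,
        mul_one]
    have hEF : E * F = Matrix.single i i 1 := by simp [hE, hF]
    calc (⁅E, x⁆ * ⁅F, x⁆).trace
        = (E * x * F * x).trace - (E * (x * x) * F).trace - (x * (E * F) * x).trace +
            (x * (E * x * F)).trace := by
          rw [Ring.lie_def, Ring.lie_def, ← Matrix.trace_sub, ← Matrix.trace_sub,
            ← Matrix.trace_add]
          congr 1
          noncomm_ring
      _ = 2 * (x i i * x j j) - (x * x) i i - (x * x) j j := by
          rw [hExF, hExF, hEF, Matrix.trace_mul_comm (x * _), ← mul_assoc,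
            Matrix.trace_mul_comm (x * x), Matrix.trace_mul_comm x, smul_mul_assoc,
            Matrix.trace_smul, Matrix.trace_smul, Matrix.trace_single_mul, Matrix.trace_single_mul,
            Matrix.trace_single_eq_same]
          simp only [smul_eq_mul]
          ring
  simp only [h, Finset.sum_sub_distrib, ← Finset.mul_sum, ← Finset.sum_mul, Finset.sum_const,
    Finset.card_univ, Fintype.card_fin, nsmul_eq_mul]
  simp only [Matrix.trace, Matrix.diag_apply]
  ring

lemma integral_trace_lie_orbit_mul_lie_orbit (hn : 1 < n) {a : Matrix (Fin n) (Fin n) ℂ}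
    (ha : a.trace = 0) (P Q : Matrix (Fin n) (Fin n) ℂ) :
    ∫ g, (⁅P, orbit a g⁆ * ⁅Q, orbit a g⁆).trace ∂haarSU n =
      -2 * n * (a * a).trace / ((n : ℂ) ^ 2 - 1) * ((P * Q).trace - P.trace * Q.trace / n) := by
  let ad (x : Matrix (Fin n) (Fin n) ℂ) := LinearMap.mulRight ℂ x - LinearMap.mulLeft ℂ x
  refine integral_bilinForm_orbit hn (b := fun x =>
    ((LinearMap.mul ℂ _).compr₂ (Matrix.traceLinearMap (Fin n) ℂ ℂ)).compl₁₂ (ad x) (ad x))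
    (fun P Q => ?_) (fun u x P Q => ?_) ?_ (fun g => ?_) P Q
  · change Continuous fun x => ((P * x - x * P) * (Q * x - x * Q)).trace
    fun_prop
  · change ((Ad u P * Ad u x - Ad u x * Ad u P) * (Ad u Q * Ad u x - Ad u x * Ad u Q)).trace =
      ((P * x - x * P) * (Q * x - x * Q)).trace
    simp only [← map_mul, ← map_sub, trace_Ad]
  · change ((1 * a - a * 1) * (1 * a - a * 1)).trace = 0
    simp
  · refine (sum_trace_lie_single_mul_lie_single (orbit a g)).trans ?_
    rw [trace_orbit, ha, trace_orbit_mul_orbit]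
    ring

end Haar

/-! ### The gradient variance -/

section Variance

variable {n : ℕ}

/-- The one-body reduced density matrix of `ρ`; the transposition of the indices makes
`tr (ρ oneBody a) = tr (oneBodyDensity ρ * a)`. -/
noncomputable def oneBodyDensity (ρ : QOp n) : Matrix (Fin n) (Fin n) ℂ :=
  Matrix.of fun i j => (ρ * (cr j * an i)).trace

lemma oneBodyDensity_apply (ρ : QOp n) (i j : Fin n) :
    oneBodyDensity ρ i j = (ρ * (cr j * an i)).trace := rfl

lemma trace_mul_oneBody (ρ : QOp n) (a : Matrix (Fin n) (Fin n) ℂ) :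
    (ρ * oneBody a).trace = (oneBodyDensity ρ * a).trace := by
  rw [oneBody_apply, Matrix.trace_mul_comm (oneBodyDensity ρ)]
  simp only [Finset.mul_sum, mul_smul_comm, Matrix.trace_sum, Matrix.trace_smul, smul_eq_mul]
  rfl

lemma isHermitian_oneBodyDensity {ρ : QOp n} (hρ : ρ.IsHermitian) :
    (oneBodyDensity ρ).IsHermitian := by
  ext i j
  rw [Matrix.conjTranspose_apply, oneBodyDensity_apply, oneBodyDensity_apply,
    ← Matrix.trace_conjTranspose, Matrix.conjTranspose_mul, Matrix.conjTranspose_mul, hρ.eq,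
    ← cr_conjTranspose, ← cr_conjTranspose, Matrix.conjTranspose_conjTranspose,
    Matrix.trace_mul_comm]

lemma re_trace_mul_eq_zero {ι : Type*} [Fintype ι] {P a : Matrix ι ι ℂ} (hP : P.IsHermitian)
    (ha : aᴴ = -a) : (P * a).trace.re = 0 := by
  have h : star (P * a).trace = -(P * a).trace := by
    rw [← Matrix.trace_conjTranspose, Matrix.conjTranspose_mul, hP.eq, ha, neg_mul,
      Matrix.trace_neg, Matrix.trace_mul_comm]
  have h_re := congrArg Complex.re h
  rw [Complex.star_def, Complex.conj_re, Complex.neg_re] at h_re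
  linarith

lemma trace_mul_self_eq_neg_stdNormSq {a : Matrix (Fin n) (Fin n) ℂ} (ha : aᴴ = -a) :
    (a * a).trace = -(stdNormSq a : ℂ) := by
  have h : star (a * a).trace = (a * a).trace := by
    rw [← Matrix.trace_conjTranspose, Matrix.conjTranspose_mul, ha, neg_mul_neg]
  rw [← Complex.conj_eq_iff_re.mp h, stdNormSq]
  simp

lemma orbit_mem_su {a : Matrix (Fin n) (Fin n) ℂ} (ha : a ∈ su n) (g : SUn n) :
    orbit a g ∈ su n := by
  refine ⟨?_, (trace_orbit a g).trans ha.2⟩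
  rw [← Matrix.star_eq_conjTranspose, ← map_star, Matrix.star_eq_conjTranspose, ha.1, map_neg]

lemma compound_conj_oneBody_SUn (g : SUn n) (a : Matrix (Fin n) (Fin n) ℂ) :
    compound g.1 * oneBody a * (compound g.1)ᴴ = oneBody (orbit a g) :=
  compound_conj_oneBody (Matrix.mem_unitaryGroup_iff'.mp (suToUnitary n g).2) a

lemma gradient_oneBody (h : Matrix (Fin n) (Fin n) ℂ) {o : Matrix (Fin n) (Fin n) ℂ} {O : QOp n}
    (hO : oneBody o = Complex.I • O) (ρ : QOp n) (g₁ g₂ : SUn n) :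
    gradient (oneBody h) O ρ g₁ g₂ =
      -Complex.I * (oneBodyDensity ρ * orbit ⁅h, orbit o g₁⁆ g₂).trace := by
  have hO' : O = -Complex.I • oneBody o := by simp [hO, smul_smul]
  rw [gradient, hO', mul_smul_comm, smul_mul_assoc, compound_conj_oneBody_SUn, lie_smul,
    oneBody_lie, mul_smul_comm, Matrix.trace_smul, smul_eq_mul, mul_assoc, mul_assoc,
    Matrix.trace_mul_comm, mul_assoc, compound_conj_oneBody_SUn, trace_mul_oneBody]

lemma ofReal_re_gradient_oneBody {h o : Matrix (Fin n) (Fin n) ℂ} (hh : h ∈ su n) (ho : o ∈ su n)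
    {O ρ : QOp n} (hO : oneBody o = Complex.I • O) (hρ : ρ.IsHermitian) (g₁ g₂ : SUn n) :
    ((gradient (oneBody h) O ρ g₁ g₂).re : ℂ) =
      -Complex.I * (oneBodyDensity ρ * orbit ⁅h, orbit o g₁⁆ g₂).trace := by
  have h_re := re_trace_mul_eq_zero (isHermitian_oneBodyDensity hρ)
    (orbit_mem_su (lie_mem_su hh (orbit_mem_su ho g₁)) g₂).1
  rw [gradient_oneBody h hO]
  apply Complex.ext <;> simp [h_re]

lemma continuous_trace_mul_orbit_lie_orbit (P h o : Matrix (Fin n) (Fin n) ℂ) :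
    Continuous fun p : SUn n × SUn n => (P * orbit ⁅h, orbit o p.1⁆ p.2).trace := by
  simp only [orbit_apply, Ring.lie_def]
  fun_prop

lemma integrable_haarSU_prod {f : SUn n × SUn n → ℂ} (hf : Continuous f) :
    Integrable f ((haarSU n).prod (haarSU n)) :=
  hf.integrable_of_hasCompactSupport (HasCompactSupport.of_compactSpace f)

lemma integral_trace_mul_orbit_lie_orbit (hn : 1 < n) (P h o : Matrix (Fin n) (Fin n) ℂ) :
    ∫ p, (P * orbit ⁅h, orbit o p.1⁆ p.2).trace ∂(haarSU n).prod (haarSU n) = 0 := by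
  rw [integral_prod _ (integrable_haarSU_prod (continuous_trace_mul_orbit_lie_orbit P h o))]
  simp only [integral_trace_mul_orbit hn (LieAlgebra.matrix_trace_commutator_zero _ _ _ _),
    integral_zero]

lemma integral_trace_mul_orbit_lie_orbit_sq (hn : 1 < n) {h o : Matrix (Fin n) (Fin n) ℂ}
    (hh : h.trace = 0) (ho : o.trace = 0) (P : Matrix (Fin n) (Fin n) ℂ) :
    ∫ p, (P * orbit ⁅h, orbit o p.1⁆ p.2).trace ^ 2 ∂(haarSU n).prod (haarSU n) =
      -(2 * n / ((n : ℂ) ^ 2 - 1) ^ 2 * ((P * P).trace - P.trace * P.trace / n) *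
        (h * h).trace * (o * o).trace) := by
  have hcont := continuous_trace_mul_orbit_lie_orbit P h o
  rw [integral_prod _ (integrable_haarSU_prod (f := fun p => _ ^ 2) (hcont.pow 2))]
  simp only [sq (Matrix.trace _),
    integral_trace_mul_orbit_mul_trace_mul_orbit hn
      (LieAlgebra.matrix_trace_commutator_zero _ _ _ _),
    integral_mul_const, integral_div, integral_trace_lie_orbit_mul_lie_orbit hn ho, hh]
  field_simp
  ring

theorem gradVar_oneBody (hn : 1 < n) {h o : Matrix (Fin n) (Fin n) ℂ} (hh : h ∈ su n)
    (ho : o ∈ su n) {O ρ : QOp n} (hO : oneBody o = Complex.I • O) (hρ : ρ.IsHermitian) :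
    (gradVar (oneBody h) O ρ : ℂ) = 2 * n / ((n : ℂ) ^ 2 - 1) ^ 2 *
      ((oneBodyDensity ρ * oneBodyDensity ρ).trace -
        (oneBodyDensity ρ).trace * (oneBodyDensity ρ).trace / n) * stdNormSq h * stdNormSq o := by
  have h_re := ofReal_re_gradient_oneBody hh ho hO hρ
  have hcont : Continuous fun p : SUn n × SUn n => (gradient (oneBody h) O ρ p.1 p.2).re := by
    simp only [gradient_oneBody h hO]
    exact Complex.continuous_re.comp
      (continuous_const.mul (continuous_trace_mul_orbit_lie_orbit _ h o))
  have hmean : ∫ p, (gradient (oneBody h) O ρ p.1 p.2).re ∂(haarSU n).prod (haarSU n) = 0 := by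
    rw [← Complex.ofReal_inj, ← integral_complex_ofReal]
    simp only [h_re, integral_const_mul, integral_trace_mul_orbit_lie_orbit hn, mul_zero,
      Complex.ofReal_zero]
  rw [gradVar, ProbabilityTheory.variance_of_integral_eq_zero hcont.measurable.aemeasurable hmean,
    ← integral_complex_ofReal]
  simp only [Complex.ofReal_pow, h_re, mul_pow, integral_const_mul,
    integral_trace_mul_orbit_lie_orbit_sq hn hh.2 ho.2, neg_sq, Complex.I_sq,
    trace_mul_self_eq_neg_stdNormSq hh.1, trace_mul_self_eq_neg_stdNormSq ho.1]
  ring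

end Variance

/-! ### The uniform superposition -/

section PlusState

variable {n : ℕ} {i j : Fin n}

lemma isHermitian_plusState (n : ℕ) : (plusState n).IsHermitian := by
  rw [plusState, Matrix.IsHermitian, Matrix.conjTranspose_vecMulVec, star_star]

lemma plusState_apply (x y : Bits n) : plusState n x y = ∏ _k : Fin n, (1 / 2 : ℂ) := by
  have h : ((1 / √2 : ℝ) : ℂ) * ((1 / √2 : ℝ) : ℂ) = 1 / 2 := by
    rw [← Complex.ofReal_mul, div_mul_div_comm, Real.mul_self_sqrt zero_le_two]
    simp
  rw [plusState, Matrix.vecMulVec_apply, Pi.star_apply, plusVec, plusVec, star_prod,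
    ← Finset.prod_mul_distrib]
  simp only [Complex.star_def, Complex.conj_ofReal, h]

lemma trace_plusState_mul_tensorOp (P : Fin n → Matrix (Fin 2) (Fin 2) ℂ) :
    (plusState n * tensorOp P).trace = ∏ k, (∑ a, ∑ b, P k a b) / 2 := by
  simp only [div_eq_inv_mul]
  rw [Finset.prod_mul_distrib, Finset.prod_univ_sum, Finset.mul_sum, Matrix.trace]
  simp only [Matrix.diag_apply, Matrix.mul_apply, plusState_apply, Fintype.piFinset_univ,
    Finset.prod_univ_sum, Finset.mul_sum, tensorOp_apply, one_div]
  exact Finset.sum_comm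

lemma sum_one_apply_div_two :
    (∑ a, ∑ b, (1 : Matrix (Fin 2) (Fin 2) ℂ) a b) / 2 = 1 := by
  simp [Matrix.one_apply]

lemma sum_σz_apply_div_two : (∑ a, ∑ b, σz a b) / 2 = 0 := by
  simp [σz]

lemma trace_plusState_mul_onQubit (A : Matrix (Fin 2) (Fin 2) ℂ) (i : Fin n) :
    (plusState n * onQubit A i).trace = (∑ a, ∑ b, A a b) / 2 := by
  rw [onQubit, trace_plusState_mul_tensorOp, Finset.prod_eq_single i]
  · rw [if_pos rfl]
  · intro k _ hk
    rw [if_neg hk, sum_one_apply_div_two]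
  · simp

lemma hasse_adj_iff_of_ne {α : Type*} [LinearOrder α] {a b : α} (hab : a ≠ b) :
    (SimpleGraph.hasse α).Adj a b ↔ ∀ c, ¬(min a b < c ∧ c < max a b) := by
  rw [SimpleGraph.hasse_adj]
  rcases hab.lt_or_gt with h | h
  · simp [CovBy, h, h.le, h.not_gt]
  · simp [CovBy, h, h.le, h.not_gt]

lemma trace_plusState_mul_pauliString_of_adj (h : (SimpleGraph.pathGraph n).Adj i j)
    (A B : Matrix (Fin 2) (Fin 2) ℂ) :
    (plusState n * pauliString A B i j).trace =
      (∑ a, ∑ b, A a b) / 2 * ((∑ a, ∑ b, B a b) / 2) := by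
  rw [pauliString, trace_plusState_mul_tensorOp, Finset.prod_eq_mul i j h.ne]
  · rw [if_pos rfl, if_neg h.ne', if_pos rfl]
  · intro k _ hk
    rw [if_neg hk.1, if_neg hk.2, if_neg ((hasse_adj_iff_of_ne h.ne).mp h k),
      sum_one_apply_div_two]
  all_goals simp

lemma trace_plusState_mul_pauliString_of_not_adj (hij : i ≠ j)
    (h : ¬(SimpleGraph.pathGraph n).Adj i j) (A B : Matrix (Fin 2) (Fin 2) ℂ) :
    (plusState n * pauliString A B i j).trace = 0 := by
  rw [SimpleGraph.pathGraph, hasse_adj_iff_of_ne hij] at h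
  push Not at h
  obtain ⟨k, hk⟩ := h
  have hki : k ≠ i := by grind
  have hkj : k ≠ j := by grind
  rw [pauliString, trace_plusState_mul_tensorOp]
  refine Finset.prod_eq_zero (Finset.mem_univ k) ?_
  rw [if_neg hki, if_neg hkj, if_pos hk, sum_σz_apply_div_two]

open Classical in
lemma oneBodyDensity_plusState (n : ℕ) :
    oneBodyDensity (plusState n) =
      (1 / 2 : ℂ) • 1 + (1 / 4 : ℂ) • (SimpleGraph.pathGraph n).adjMatrix ℂ := by
  have h_raise : ∑ a, ∑ b, raiseMat a b = 1 := by simp [raiseMat]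
  have h_lower : ∑ a, ∑ b, lowerMat a b = 1 := by simp [lowerMat]
  have h_number : ∑ a, ∑ b, (raiseMat * lowerMat) a b = 1 := by simp [raiseMat, lowerMat]
  ext i j
  rw [oneBodyDensity_apply, Matrix.add_apply, Matrix.smul_apply, Matrix.smul_apply,
    SimpleGraph.adjMatrix_apply]
  rcases eq_or_ne i j with rfl | hij
  · rw [cr_mul_an_self, trace_plusState_mul_onQubit, h_number]
    simp
  · rw [cr_mul_an_of_ne hij.symm]
    by_cases h : (SimpleGraph.pathGraph n).Adj i j
    · rw [trace_plusState_mul_pauliString_of_adj h.symm, h_raise, h_lower]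
      norm_num [h, hij]
    · rw [trace_plusState_mul_pauliString_of_not_adj hij.symm fun h' => h h'.symm]
      simp [h, hij]

lemma sum_ite_val_add_one_eq (m : ℕ) :
    ∑ i : Fin (m + 1), ∑ j : Fin (m + 1), (if i.val + 1 = j.val then (1 : ℂ) else 0) = m := by
  rw [Finset.sum_comm, Fin.sum_univ_succ]
  have h (i : Fin (m + 1)) (k : Fin m) : i.val + 1 = k.succ.val ↔ i = k.castSucc := by
    simp [Fin.ext_iff]
  simp only [h, Finset.sum_ite_eq', Finset.mem_univ, if_true]
  simp

open Classical in
lemma trace_adjMatrix_pathGraph_mul_self (hn : n ≠ 0) :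
    ((SimpleGraph.pathGraph n).adjMatrix ℂ * (SimpleGraph.pathGraph n).adjMatrix ℂ).trace =
      2 * (n - 1) := by
  obtain ⟨m, rfl⟩ := Nat.exists_eq_succ_of_ne_zero hn
  have h (i j : Fin (m + 1)) : (SimpleGraph.pathGraph (m + 1)).adjMatrix ℂ i j *
      (SimpleGraph.pathGraph (m + 1)).adjMatrix ℂ j i =
        (if i.val + 1 = j.val then 1 else 0) + (if j.val + 1 = i.val then 1 else 0) := by
    simp only [SimpleGraph.adjMatrix_apply, SimpleGraph.pathGraph_adj]
    split_ifs <;> first | omega | simp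
  simp only [Matrix.trace, Matrix.diag_apply, Matrix.mul_apply, h, Finset.sum_add_distrib]
  rw [sum_ite_val_add_one_eq, Finset.sum_comm, sum_ite_val_add_one_eq]
  push_cast
  ring

lemma trace_oneBodyDensity_plusState (n : ℕ) : (oneBodyDensity (plusState n)).trace = n / 2 := by
  classical
  rw [oneBodyDensity_plusState, Matrix.trace_add, Matrix.trace_smul, Matrix.trace_smul,
    SimpleGraph.trace_adjMatrix, Matrix.trace_one, Fintype.card_fin]
  simp [div_eq_inv_mul]

lemma trace_oneBodyDensity_plusState_mul_self (hn : n ≠ 0) :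
    (oneBodyDensity (plusState n) * oneBodyDensity (plusState n)).trace =
      n / 4 + (n - 1) / 8 := by
  classical
  rw [oneBodyDensity_plusState]
  simp only [add_mul, mul_add, smul_mul_smul_comm, mul_one, one_mul, Matrix.trace_add,
    Matrix.trace_smul, SimpleGraph.trace_adjMatrix, trace_adjMatrix_pathGraph_mul_self hn,
    Matrix.trace_one, Fintype.card_fin, smul_eq_mul]
  ring

theorem gradVar_plusState (hn : 1 < n) {h o : Matrix (Fin n) (Fin n) ℂ} (hh : h ∈ su n)
    (ho : o ∈ su n) {O : QOp n} (hO : dcompound o = Complex.I • O) :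
    gradVar (dcompound h) O (plusState n) =
      (n * (n - 1) : ℝ) / (4 * ((n : ℝ) ^ 2 - 1) ^ 2) * stdNormSq h * stdNormSq o := by
  have hn0 : (n : ℂ) ≠ 0 := Nat.cast_ne_zero.mpr hn.ne_bot
  have hn1 := natCast_sq_sub_one_ne_zero hn
  rw [dcompound_eq_oneBody] at hO ⊢
  rw [← Complex.ofReal_inj, gradVar_oneBody hn hh ho hO (isHermitian_plusState n),
    trace_oneBodyDensity_plusState, trace_oneBodyDensity_plusState_mul_self hn.ne_bot]
  push_cast
  field_simp
  ring

theorem gradVar_plusState_of_mem_generators (hn : 1 < n) {H K O : QOp n} (hH : H ∈ generators n)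
    (hK : K ∈ generators n) (hO : O = Complex.I • K ∨ O = -(Complex.I • K)) :
    gradVar H O (plusState n) = (n * (n - 1) : ℝ) / (16 * ((n : ℝ) ^ 2 - 1) ^ 2) := by
  obtain ⟨h, hh, rfl, h_norm⟩ := exists_su_of_mem_generators hH
  obtain ⟨k, hk, rfl, k_norm⟩ := exists_su_of_mem_generators hK
  obtain ⟨o, ho, hoO, o_norm⟩ : ∃ o ∈ su n, dcompound o = Complex.I • O ∧ stdNormSq o = 1 / 2 := by
    simp only [dcompound_eq_oneBody] at hO ⊢
    rcases hO with rfl | rfl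
    · exact ⟨-k, (suSubmodule n).neg_mem hk, by simp [smul_smul], by simpa [stdNormSq] using k_norm⟩
    · exact ⟨k, hk, by simp [smul_smul], k_norm⟩
  rw [gradVar_plusState hn hh ho hoO, h_norm, o_norm]
  generalize (n : ℝ) ^ 2 - 1 = d
  ring

end PlusState

/-! ### Rates -/

section Rates

lemma isTheta_natCast_pow_sub_one {k : ℕ} (hk : k ≠ 0) :
    (fun n : ℕ => (n : ℝ) ^ k - 1) =Θ[atTop] fun n : ℕ => (n : ℝ) ^ k := by
  have h : Tendsto (fun n : ℕ => (n : ℝ) ^ k) atTop atTop :=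
    (tendsto_pow_atTop hk).comp tendsto_natCast_atTop_atTop
  have h_one : (fun _ : ℕ => (1 : ℝ)) =o[atTop] fun n : ℕ => (n : ℝ) ^ k :=
    (isLittleO_one_left_iff ℝ).mpr (tendsto_norm_atTop_atTop.comp h)
  exact (IsEquivalent.refl.sub_isLittleO h_one).isTheta

lemma isTheta_inv_finrank_dla :
    (fun n : ℕ => 1 / (Module.finrank ℝ (dla n) : ℝ)) =Θ[atTop] fun n : ℕ => 1 / (n : ℝ) ^ 2 := by
  have hd : (fun n : ℕ => 1 / (Module.finrank ℝ (dla n) : ℝ)) =ᶠ[atTop]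
      fun n : ℕ => 1 / ((n : ℝ) ^ 2 - 1) := by
    filter_upwards [eventually_ne_atTop 0] with n hn
    rw [finrank_dla hn, Nat.cast_sub (Nat.one_le_pow _ _ (Nat.pos_of_ne_zero hn))]
    simp
  exact hd.trans_isTheta ((isTheta_refl _ _).div (isTheta_natCast_pow_sub_one two_ne_zero))

lemma isTheta_gradVar_prefactor :
    (fun n : ℕ => (n * (n - 1) : ℝ) / (4 * ((n : ℝ) ^ 2 - 1) ^ 2)) =Θ[atTop]
      fun n : ℕ => 1 / (n : ℝ) ^ 2 := by
  have h_sub : (fun n : ℕ => (n : ℝ) - 1) =Θ[atTop] fun n : ℕ => (n : ℝ) := by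
    simpa only [pow_one] using isTheta_natCast_pow_sub_one one_ne_zero
  have h_den : (fun n : ℕ => 4 * ((n : ℝ) ^ 2 - 1) ^ 2) =Θ[atTop] fun n : ℕ => ((n : ℝ) ^ 2) ^ 2 :=
    ((isTheta_natCast_pow_sub_one two_ne_zero).pow 2).const_mul_left four_ne_zero
  refine (((isTheta_refl _ _).mul h_sub).div h_den).trans_eventuallyEq ?_
  filter_upwards [eventually_ne_atTop 0] with n hn
  field_simp

theorem isTheta_gradVar_plusState {H O : ∀ n : ℕ, QOp n} {o : ∀ n : ℕ, Matrix (Fin n) (Fin n) ℂ}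
    (hH : ∀ᶠ n in atTop, H n ∈ generators n)
    (ho : ∀ᶠ n in atTop, o n ∈ su n ∧ dcompound (o n) = Complex.I • O n)
    (ho_norm : (fun n => stdNormSq (o n)) =Θ[atTop] fun _ => (1 : ℝ)) :
    (fun n => gradVar (H n) (O n) (plusState n)) =Θ[atTop] fun n : ℕ => 1 / (n : ℝ) ^ 2 := by
  have hvar : (fun n => gradVar (H n) (O n) (plusState n)) =ᶠ[atTop] fun n : ℕ =>
      (n * (n - 1) : ℝ) / (4 * ((n : ℝ) ^ 2 - 1) ^ 2) * (1 / 2 * stdNormSq (o n)) := by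
    filter_upwards [eventually_gt_atTop 1, hH, ho] with n hn hHn ⟨hon, hOn⟩
    obtain ⟨h, hh, h_eq, h_norm⟩ := exists_su_of_mem_generators hHn
    rw [← h_eq, gradVar_plusState hn hh hon hOn, h_norm, mul_assoc]
  refine hvar.trans_isTheta ?_
  simpa only [mul_one] using
    isTheta_gradVar_prefactor.mul (ho_norm.const_mul_left (c := 1 / 2) (by norm_num))

end Rates

end CompoundAnsatz

theorem theorem6 :
    (∀ n : ℕ, 2 ≤ n →
      -- the dynamical Lie algebra is the image of `su(n)` and has dimension `n² - 1`
      (dla n : Set (QOp n)) = dcompound '' su n ∧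
      Module.finrank ℝ (dla n) = n ^ 2 - 1 ∧
      -- the generators have squared standard norm `1/2`
      (∀ H ∈ generators n, ∃ h ∈ su n, dcompound h = H ∧ stdNormSq h = 1 / 2) ∧
      -- the gradient variance of a general LASA
      (∀ h ∈ su n, ∀ o ∈ su n, ∀ O : QOp n, IsLASA n O → dcompound o = Complex.I • O →
        gradVar (dcompound h) O (plusState n) =
          (n * (n - 1) : ℝ) / (4 * ((n : ℝ) ^ 2 - 1) ^ 2) * stdNormSq h * stdNormSq o) ∧
      -- the gradient variance when the observable is `± i` times a generator
      (∀ H ∈ generators n, ∀ K ∈ generators n, ∀ O : QOp n,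
        (O = Complex.I • K ∨ O = -(Complex.I • K)) →
        gradVar H O (plusState n) = (n * (n - 1) : ℝ) / (16 * ((n : ℝ) ^ 2 - 1) ^ 2))) ∧
    -- the rate, for every sequence of LASAs with observables of order one
    (∀ (H O : ∀ n : ℕ, QOp n) (o : ∀ n : ℕ, Matrix (Fin n) (Fin n) ℂ),
      (∀ n, 2 ≤ n → H n ∈ generators n ∧ IsLASA n (O n) ∧
        o n ∈ su n ∧ dcompound (o n) = Complex.I • O n) →
      (fun n => stdNormSq (o n)) =Θ[atTop] (fun _ => (1 : ℝ)) →
      (fun n => gradVar (H n) (O n) (plusState n)) =Θ[atTop] (fun n : ℕ => 1 / (n : ℝ) ^ 2) ∧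
      (fun n => gradVar (H n) (O n) (plusState n)) =Θ[atTop]
        (fun n : ℕ => 1 / (Module.finrank ℝ (dla n) : ℝ))) := by
  refine ⟨fun n hn => ⟨coe_dla n, finrank_dla (by lia), fun H => exists_su_of_mem_generators,
    fun h hh o ho O _ => gradVar_plusState hn hh ho,
    fun H hH K hK O => gradVar_plusState_of_mem_generators hn hH hK⟩, fun H O o hseq ho_norm => ?_⟩
  have hseq' : ∀ᶠ n in atTop, H n ∈ generators n ∧ IsLASA n (O n) ∧
      o n ∈ su n ∧ dcompound (o n) = Complex.I • O n :=
    (eventually_ge_atTop 2).mono hseq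
  have hrate := isTheta_gradVar_plusState (hseq'.mono fun _ h => h.1)
    (hseq'.mono fun _ h => h.2.2) ho_norm
  exact ⟨hrate, hrate.trans isTheta_inv_finrank_dla.symm⟩
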